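/- **Setting.** Let $\mathcal H$ be a class of functions $X\to\{0,1\}$ of finite Littlestone dimension $d$. Let $A$ be a deterministic online learner, which assigns to every finite sequence $S$ of labelled examples a predictor $A(S):X\to\{0,1\}$, and suppose that $A$ makes at most $d$ mistakes on every sequence that is realizable by $\mathcal H$. Put $A(\perp)=\perp$ for an extra symbol $\perp$. Let $(x_1,y_1),\dots,(x_T,y_T)$ be a fixed (oblivious) sequence of labelled examples. **Forest procedure.** Take $k_2$ complete binary trees, each with $k_1$ leaves ($k_1$ a power of $2$). Write $\mathrm s(v)$ for the sibling of a vertex $v$. At every time a set $\mathcal V$ of pertinent vertices, a sample $S_v$ for each vertex $v$, and one output vertex $v^{(i)}$ for each tree $i$ are maintained. Initially $\mathcal V$ is the set of all leaves, $S_v=\emptyset$ for each leaf, $S_v=\perp$ for each other vertex, and $v^{(i)}$ is an arbitrary leaf of tree $i$. Draw a leaf $\pi(t)$ of the forest for each $t\le T$, and a label $y_v\in\{0,1\}$ for each vertex $v$, all uniformly and independently. At the beginning of round $t$ let $L_t$ be the list $\big(A(S_{v^{(i)}})\big)_{i=1}^{k_2}$. Then round $t$ proceeds as follows. 1. Let $v_1$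 be the unique vertex of $\mathcal V$ on the path from $\pi(t)$ to the root of its tree. If $v_1$ is the root, the round ends. Otherwise let $v_2=\mathrm s(v_1)$ and append $(x_t,y_t)$ to $S_{v_1}$. 2. While $v_1,v_2\in\mathcal V$ and $A(S_{v_1})\ne A(S_{v_2})$: let $\bar v$ be the parent of $v_1,v_2$; let $x_{\bar v}$ be a point on which $A(S_{v_1})$ and $A(S_{v_2})$ differ, selected by an arbitrary rule, fixed in advance, from $t$, $S_{v_1}$ and $S_{v_2}$; let $S_{\bar v}$ be $S_{v_j}$ followed by $(x_{\bar v},y_{\bar v})$, where $j\in\{1,2\}$ is the index with $A(S_{v_j})(x_{\bar v})\ne y_{\bar v}$; replace $v_1,v_2$ by $\bar v$ in $\mathcal V$; stop if $\bar v$ is the root, and otherwise continue with $v_1=\bar v$, $v_2=\mathrm s(\bar v)$. 3. If the body of the loop was executed at least once, in tree $i$ say, let $v^{(i)}$ be a uniformly random element, drawn with fresh randomness, of the set of vertices $v$ of tree $i$ with $v,\mathrm s(v)\in\mathcal V$ and $A(S_v)=A(S_{\mathrm s(v)})$. If this set is empty, let $v^{(i)}$ be the root of tree $i$, set $S_{v^{(i)}}=\perp$,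 and make the root the only pertinent vertex of tree $i$. For a list $L$ of length $k$ put $\mathrm{freq}_L(f)=\frac1k\,|\{i\le k: L_i=f\}|$, and let $\eta=2^{-4k_1-2}/k_1$. Let $\log$ be the natural logarithm. **Lemma.** Suppose that there is $h^\star\in\mathcal H$ with $h^\star(x_t)=y_t$ for all $t\le T$, and let $\beta>0$. If $$k_1\ge\max\{2^{d+1},20\}\qquad\text{and}\qquad k_2\ge 2^{8k_1+6}\,k_1^2\,\log\frac{5T\log k_1}{\beta},$$ then with probability at least $1-\beta$, for every round $t\le T$ there is a predictor $f:X\to\{0,1\}$ (so $f\ne\perp$) with $\mathrm{freq}_{L_t}(f)\ge\eta$. -/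

import Mathlib

open MeasureTheory ProbabilityTheory

namespace DPSOA

/-! ### Online learning -/

/-- A finite sequence of labelled examples, in chronological order. -/
abbrev Sample (X : Type*) := List (X × Bool)

/-- A deterministic online learner: after a sequence of labelled examples it holds a predictor. -/
abbrev Learner (X : Type*) := Sample X → X → Bool

/-- The sample is consistent with some hypothesis of the class. -/
def Realizable {X : Type*} (H : Set (X → Bool)) (S : Sample X) : Prop :=
  ∃ h ∈ H, ∀ z ∈ S, h z.1 = z.2

/-- The number of mistakes of the learner when the examples of `S` are presented in order:
the `j`-th one is predicted from the examples before it. -/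
def mistakes {X : Type*} (A : Learner X) (S : Sample X) : ℕ :=
  (Finset.univ.filter (fun j : Fin S.length => A (S.take j) (S.get j).1 ≠ (S.get j).2)).card

/-- At most `d` mistakes on every sequence that is realizable by the class `H`. -/
def HasMistakeBound {X : Type*} (A : Learner X) (H : Set (X → Bool)) (d : ℕ) : Prop :=
  ∀ S : Sample X, Realizable H S → mistakes A S ≤ d

/-- Mistake trees of depth `n`: complete binary trees whose inner nodes carry points; the two
out-edges of an inner node are labelled by `false` and `true`. -/
inductive MistakeTree (X : Type*) : ℕ → Type _
  | leaf : MistakeTree X 0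
  | node {n : ℕ} (x : X) (child : Bool → MistakeTree X n) : MistakeTree X (n + 1)

/-- The labelled sequence along the root-to-leaf path with edge labels `b`. -/
def MistakeTree.path {X : Type*} : {n : ℕ} → MistakeTree X n → (Fin n → Bool) → Sample X
  | _, .leaf, _ => []
  | _, .node x child, b => (x, b 0) :: (child (b 0)).path (fun i => b i.succ)

/-- Every root-to-leaf path is realized by a hypothesis of the class. -/
def MistakeTree.ShatteredBy {X : Type*} {n : ℕ} (t : MistakeTree X n) (H : Set (X → Bool)) : Prop :=
  ∀ b : Fin n → Bool, Realizable H (t.path b)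

/-- The Littlestone dimension: the largest depth of a shattered mistake tree. -/
noncomputable def littlestoneDim {X : Type*} (H : Set (X → Bool)) : ℕ∞ :=
  ⨆ (n : ℕ) (_ : ∃ t : MistakeTree X n, t.ShatteredBy H), (n : ℕ∞)

/-! ### The binary trees of the forest -/

/-- The vertices of the complete binary tree with `2 ^ m` leaves. A vertex is coded by the word of
left/right turns that leads to it from the root, the last turn first: the root is `[]` and the
parent of `b :: p` is `p`. -/
abbrev Vertex (m : ℕ) := {l : List Bool // l.length ≤ m}

/-- The leaves are the words of length `m`. -/
abbrev Leaf (m : ℕ) := List.Vector Bool m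

noncomputable instance (m : ℕ) : Fintype (Vertex m) :=
  (List.finite_length_le Bool m).fintype

/-- A leaf, as a vertex. -/
def Leaf.toVertex {m : ℕ} (l : Leaf m) : Vertex m := ⟨l.1, l.2.le⟩

/-- The root of the tree. -/
def root (m : ℕ) : Vertex m := ⟨[], Nat.zero_le m⟩

/-- The sibling of a vertex (by convention the root for the root). -/
def sib {m : ℕ} : Vertex m → Vertex m
  | ⟨[], h⟩ => ⟨[], h⟩
  | ⟨b :: p, h⟩ => ⟨(!b) :: p, h⟩

/-- The parent of a vertex (by convention the root for the root). -/
def parent {m : ℕ} : Vertex m → Vertex m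
  | ⟨[], h⟩ => ⟨[], h⟩
  | ⟨_ :: p, h⟩ => ⟨p, (Nat.le_succ p.length).trans h⟩

/-- The state of one tree: its pertinent vertices, the samples `S_v` (`none` stands for `⊥`), and
the vertex whose predictor the tree currently outputs. -/
structure TreeState (X : Type*) (m : ℕ) where
  pertinent : Finset (Vertex m)
  sample : Vertex m → Option (Sample X)
  out : Vertex m

section Tree

variable {X : Type*} {m : ℕ}

/-- `A(S_v)`, where `A(⊥) = ⊥`. -/
def predictor (A : Learner X) (st : TreeState X m) (v : Vertex m) : Option (X → Bool) :=
  (st.sample v).map A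

/-- Initially the leaves are pertinent, with empty samples; all other samples are `⊥`. -/
noncomputable def initTree (v₀ : Leaf m) : TreeState X m where
  pertinent := Finset.univ.filter (fun v => v.1.length = m)
  sample := fun v => if v.1.length = m then some [] else none
  out := v₀.toVertex

/-- The pertinent antecedent of the vertex coded by a word (the lowest one; in the procedure it is
unique). -/
def antecedent (P : Finset (Vertex m)) : (l : List Bool) → l.length ≤ m → Option (Vertex m)
  | [], h => if (⟨[], h⟩ : Vertex m) ∈ P then some ⟨[], h⟩ else none
  | b :: p, h =>
      if (⟨b :: p, h⟩ : Vertex m) ∈ P then some ⟨b :: p, h⟩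
      else antecedent P p ((Nat.le_succ p.length).trans h)

/-- The condition of the while loop at `v₁ = v`, `v₂ = sib v`. -/
def Clash (A : Learner X) (st : TreeState X m) (v : Vertex m) : Prop :=
  predictor A st v ≠ predictor A st (sib v) ∧ v ∈ st.pertinent ∧ sib v ∈ st.pertinent

/-- The body of the while loop at `v₁ = v`, `v₂ = sib v`: with `x` a point on which the two
predictors disagree, and `y` the guessed label of the parent, the parent gets the sample of that
one of the two vertices whose predictor errs on `(x, y)`, extended by `(x, y)`; the parent replaces
the two vertices in the pertinent set. -/
def merge (A : Learner X) (pick : Sample X → Sample X → X) (guess : Vertex m → Bool)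
    (st : TreeState X m) (v : Vertex m) : TreeState X m where
  pertinent := insert (parent v) ((st.pertinent.erase v).erase (sib v))
  sample := Function.update st.sample (parent v)
    (match st.sample v, st.sample (sib v) with
      | some S₁, some S₂ =>
          let x := pick S₁ S₂
          let y := guess (parent v)
          some ((if A S₁ x ≠ y then S₁ else S₂) ++ [(x, y)])
      | _, _ => none)
  out := st.out

open Classical in
/-- The while loop, started at the vertex `v₁` coded by the given word. -/
noncomputable def whileLoop (A : Learner X) (pick : Sample X → Sample X → X)
    (guess : Vertex m → Bool) :
    (l : List Bool) → l.length ≤ m → TreeState X m → TreeState X m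
  | [], _, st => st
  | b :: p, h, st =>
      if Clash A st ⟨b :: p, h⟩ then
        whileLoop A pick guess p ((Nat.le_succ p.length).trans h)
          (merge A pick guess st ⟨b :: p, h⟩)
      else st

open Classical in
/-- The vertices among which the output vertex is chosen: `v` and its sibling are pertinent and
have the same predictor. -/
noncomputable def collisions (A : Learner X) (st : TreeState X m) : Finset (Vertex m) :=
  st.pertinent.filter (fun v =>
    v ≠ root m ∧ sib v ∈ st.pertinent ∧ predictor A st v = predictor A st (sib v))

/-- A rule that chooses an element of every nonempty set of vertices. For a uniformly random rule
and a fixed set `s`, the chosen element is uniformly distributed on `s`. -/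
abbrev Chooser (m : ℕ) := (s : {s : Finset (Vertex m) // s.Nonempty}) → {v : Vertex m // v ∈ s.1}

open Classical in
/-- The choice of a new output vertex after the while loop has been executed. If there is no
candidate, then only the root stays pertinent, with the sample `⊥`. -/
noncomputable def reselect (A : Learner X) (ρ : Chooser m) (st : TreeState X m) : TreeState X m :=
  if h : (collisions A st).Nonempty then
    { st with out := (ρ ⟨collisions A st, h⟩).1 }
  else
    { pertinent := {root m}
      sample := Function.update st.sample (root m) none
      out := root m }

open Classical in
/-- What happens in a tree when the example `z` is assigned to its leaf `l`. -/
noncomputable def treeRound (A : Learner X) (pick : Sample X → Sample X → X)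
    (guess : Vertex m → Bool) (ρ : Chooser m) (l : Leaf m) (z : X × Bool)
    (st : TreeState X m) : TreeState X m :=
  match antecedent st.pertinent l.1 l.2.le with
  | none => st
  | some v =>
      if v = root m then st
      else
        let st₁ : TreeState X m :=
          { st with sample := Function.update st.sample v ((st.sample v).map (· ++ [z])) }
        if Clash A st₁ v then reselect A ρ (whileLoop A pick guess v.1 v.2 st₁) else st₁

end Tree

/-! ### The forest -/

/-- The random bits of the forest procedure over `T` rounds, for `k₂` trees with `2 ^ m` leaves:
the leaf to which each example is assigned, the guessed label of each vertex, and the random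
choices of output vertices. -/
structure Seed (T k₂ m : ℕ) where
  assign : Fin T → Fin k₂ × Leaf m
  guess : Fin k₂ → Vertex m → Bool
  chooser : Fin T → Chooser m

instance (T k₂ m : ℕ) : MeasurableSpace (Seed T k₂ m) := ⊤

/-- The uniform distribution on the finite set of seeds: all random bits are independent and
uniform. -/
noncomputable def seedLaw (T k₂ m : ℕ) : Measure (Seed T k₂ m) := uniformOn Set.univ

/-- The state of the forest after the first `n` rounds. -/
noncomputable def forestState {X : Type*} {T k₂ m : ℕ} (A : Learner X)
    (pick : Fin T → Sample X → Sample X → X) (v₀ : Fin k₂ → Leaf m) (data : Fin T → X × Bool)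
    (ω : Seed T k₂ m) : ℕ → Fin k₂ → TreeState X m
  | 0 => fun i => initTree (v₀ i)
  | n + 1 =>
      let F := forestState A pick v₀ data ω n
      if h : n < T then
        let t : Fin T := ⟨n, h⟩
        let i := (ω.assign t).1
        Function.update F i
          (treeRound A (pick t) (ω.guess i) (ω.chooser t) (ω.assign t).2 (data t) (F i))
      else F

/-- The list `L_t` of the outputs of the trees at the beginning of round `t` (rounds are numbered
from `0`, so `t` rounds have been completed). -/
noncomputable def outputs {X : Type*} {T k₂ m : ℕ} (A : Learner X)
    (pick : Fin T → Sample X → Sample X → X) (v₀ : Fin k₂ → Leaf m) (data : Fin T → X × Bool)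
    (ω : Seed T k₂ m) (t : Fin T) : Fin k₂ → Option (X → Bool) :=
  fun i =>
    let st := forestState A pick v₀ data ω t i
    predictor A st st.out

open Classical in
/-- The frequency of `a` in the list `L`. -/
noncomputable def freq {α : Type*} {k : ℕ} (L : Fin k → α) (a : α) : ℝ :=
  (1 / (k : ℝ)) * ∑ i, if L i = a then 1 else 0

/-- The frequency threshold `η = 2 ^ (-4 k₁ - 2) / k₁`. -/
noncomputable def eta (k₁ : ℕ) : ℝ := 1 / (2 ^ (4 * k₁ + 2) * (k₁ : ℝ))

end DPSOA

namespace DPSOA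

/-! ### Words and suffixes -/

section Words

variable {m : ℕ}

/-! Fix a round, write `K = 2 ^ m`, `x = 2 ^ K` and `k` for the number of trees. Call a pair `a`,
`sib a` eligible in a tree if both are pertinent, carry the same predictor `f`, and can be the
output pair. At the end of a round no two pertinent siblings disagree, so every pertinent pair of
siblings carries one predictor.

Many trees have an eligible pair. If all guesses made in a tree agree with the target hypothesis,
every pertinent sample is realizable and contains one mistake per level climbed (`Progress`). The
root would then need `m > d` mistakes, so it is not pertinent, and a deepest pertinent vertex has a
pertinent sibling. The at most `K` inner guesses are right with probability at least `1 / x`,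
independently across trees (`exists_guess_eligible`, `card_few_eligible_le`). By pigeonhole over the
at most `2 * K` vertices, one vertex `a` is eligible in at least `2 * p * k` trees, where `p = 1 /
(8 * K * x)`.

Many of these trees share a predictor. Permuting the contents of the subtrees at `sib a` among the
trees preserves the uniform law. Consider the `k × k` matrix whose entry `(i, j)` describes tree `i`
with that subtree taken from tree `j`; the real forest is its diagonal, which behaves like a random
matching. Sparse matrices rarely have heavy diagonals, so more than `p * k ^ 2` entries are eligible
(`card_sparse_le`). Before `a` and `sib a` are merged, the predictor at `a` depends only on the row
and the one at `sib a` only on the column (`entry_row`, `entry_col`). As the two coincide in an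
eligible entry, labels are constant along rows and columns, and some `f` labels at least `p ^ 2 * k
^ 2` entries (`exists_frequent_label`). The choice of `f` is invariant under the permutations, so
the diagonal contains `f` more than `p ^ 2 * k / 2` times (`card_dense_le`).

Many of those trees output `f`. Pertinent sets and samples do not depend on the output choices
(`treeRun_core`). Given everything else, each such tree outputs `a` with certainty or with
probability at least `1 / (2 * K)`, through a choice in a round of its own (`card_few_out_le`). The
resulting count exceeds `eta * k`. The exceptional events cost at most `7 * K * exp (-(p ^ 4 * k /
32))` per round, and `tail_bound` sums this over the rounds. -/

theorem exists_cons_suffix {p w : List Bool} (h : p <:+ w) (hne : p ≠ w) :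
    ∃ c, c :: p <:+ w := by
  obtain ⟨t, rfl⟩ := h
  rcases List.eq_nil_or_concat t with rfl | ⟨t', c, rfl⟩
  · exact absurd rfl hne
  · exact ⟨c, t', by simp⟩

theorem suffix_antisymm {p w : List Bool} (h : p <:+ w) (h' : w <:+ p) : p = w :=
  h.eq_of_length_le h'.length_le

theorem not_cons_suffix_self (b : Bool) (p : List Bool) : ¬ (b :: p <:+ p) := fun h => by
  have := h.length_le
  simp at this

theorem cons_suffix_unique {b c : Bool} {p w : List Bool} (h : b :: p <:+ w) (h' : c :: p <:+ w) :
    b = c := by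
  rcases List.suffix_or_suffix_of_suffix h h' with h1 | h1
  · have := h1.eq_of_length_le (by simp)
    simp at this; exact this
  · have := h1.eq_of_length_le (by simp)
    simp at this; exact this.symm

theorem vertex_ne_root_iff {v : Vertex m} : v ≠ root m ↔ ∃ b p h, v = ⟨b :: p, h⟩ := by
  obtain ⟨l, h⟩ := v
  cases l with
  | nil => simp [root]
  | cons b p =>
    simp only [root, ne_eq, Subtype.mk.injEq, reduceCtorEq, not_false_eq_true, true_iff]
    exact ⟨b, p, h, rfl⟩

theorem sib_sib (v : Vertex m) : sib (sib v) = v := by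
  obtain ⟨l, h⟩ := v
  cases l <;> simp [sib]

theorem sib_ne_root {v : Vertex m} (hv : v ≠ root m) : sib v ≠ root m := by
  obtain ⟨b, p, h, rfl⟩ := vertex_ne_root_iff.1 hv
  simp [sib, root]

theorem exists_leaf_suffix (v : Vertex m) : ∃ l : Leaf m, v.1 <:+ l.1 :=
  ⟨⟨List.replicate (m - v.1.length) false ++ v.1, by
    have := v.2
    simp; omega⟩, List.suffix_append _ _⟩

end Words

/-! ### Frontiers -/

section Frontier

variable {X : Type*} {m : ℕ}

/-- The vertex or one of its antecedents belongs to the set. -/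
def Covered (P : Finset (Vertex m)) (v : Vertex m) : Prop := ∃ u ∈ P, u.1 <:+ v.1

/-- Every leaf has a unique antecedent in the set. -/
structure Frontier (P : Finset (Vertex m)) : Prop where
  cover : ∀ l : Leaf m, Covered P l.toVertex
  antichain : ∀ u ∈ P, ∀ v ∈ P, u.1 <:+ v.1 → u = v

/-- A member above `u` would also lie above `v`, hence equal `v`. So everything strictly above a
pertinent vertex is still untouched; this is what makes `Covered` a record of which merges have
happened. -/
theorem Frontier.not_covered {P : Finset (Vertex m)} (hP : Frontier P) {u v : Vertex m}
    (hv : v ∈ P) (huv : u.1 <:+ v.1) (hne : u ≠ v) : ¬ Covered P u := by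
  rintro ⟨w, hw, hwu⟩
  have := hP.antichain w hw v hv (hwu.trans huv)
  subst this
  exact hne (Subtype.ext (suffix_antisymm huv hwu))

theorem Frontier.eq_of_suffix {P : Finset (Vertex m)} (hP : Frontier P) {u v : Vertex m}
    (hu : u ∈ P) (hv : v ∈ P) {l : List Bool} (hul : u.1 <:+ l) (hvl : v.1 <:+ l) : u = v := by
  rcases List.suffix_or_suffix_of_suffix hul hvl with h | h
  · exact hP.antichain u hu v hv h
  · exact (hP.antichain v hv u hu h).symm

theorem frontier_root : Frontier ({root m} : Finset (Vertex m)) where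
  cover l := ⟨root m, by simp, List.nil_suffix⟩
  antichain u hu v hv _ := by simp at hu hv; rw [hu, hv]

theorem frontier_initTree (v₀ : Leaf m) :
    Frontier (initTree (X := X) v₀).pertinent where
  cover l := ⟨l.toVertex, by simp [initTree, Leaf.toVertex], List.suffix_refl _⟩
  antichain u hu v hv h := by
    simp only [initTree, Finset.mem_filter, Finset.mem_univ, true_and] at hu hv
    exact Subtype.ext (h.eq_of_length (by rw [hu, hv]))

theorem antecedent_eq_some {P : Finset (Vertex m)} {l : List Bool} {h : l.length ≤ m}
    {v : Vertex m} (hv : antecedent P l h = some v) : v ∈ P ∧ v.1 <:+ l := by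
  induction l with
  | nil =>
    rw [antecedent] at hv
    split_ifs at hv with h1
    simp at hv; subst hv
    exact ⟨h1, List.suffix_refl _⟩
  | cons b p ih =>
    rw [antecedent] at hv
    split_ifs at hv with h1
    · simp at hv; subst hv
      exact ⟨h1, List.suffix_refl _⟩
    · have := ih hv
      exact ⟨this.1, this.2.trans (List.suffix_cons _ _)⟩

theorem antecedent_eq_none {P : Finset (Vertex m)} {l : List Bool} {h : l.length ≤ m}
    (hv : antecedent P l h = none) (v : Vertex m) (hvP : v ∈ P) : ¬ v.1 <:+ l := by
  induction l with
  | nil =>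
    rw [antecedent] at hv
    split_ifs at hv with h1
    intro h2
    have : v.1 = [] := List.eq_nil_of_suffix_nil h2
    exact h1 (by convert hvP; exact this.symm)
  | cons b p ih =>
    rw [antecedent] at hv
    split_ifs at hv with h1
    intro h2
    rcases List.suffix_cons_iff.1 h2 with h3 | h3
    · exact h1 (by convert hvP; exact h3.symm)
    · exact ih hv h3

theorem Frontier.antecedent_eq {P : Finset (Vertex m)} (hP : Frontier P) {l : Leaf m}
    {v : Vertex m} (hv : v ∈ P) (hvl : v.1 <:+ l.1) : antecedent P l.1 l.2.le = some v := by
  rcases h : antecedent P l.1 l.2.le with _ | u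
  · exact absurd hvl (antecedent_eq_none h v hv)
  · obtain ⟨h1, h2⟩ := antecedent_eq_some h
    rw [hP.eq_of_suffix h1 hv h2 hvl]

theorem Frontier.exists_antecedent {P : Finset (Vertex m)} (hP : Frontier P) (l : Leaf m) :
    ∃ v, antecedent P l.1 l.2.le = some v ∧ v ∈ P ∧ v.1 <:+ l.1 := by
  obtain ⟨v, hv, hvl⟩ := hP.cover l
  exact ⟨v, hP.antecedent_eq hv hvl, hv, hvl⟩

/-- The frontier, unless it is the root, contains a pair of siblings of maximal depth. -/
theorem Frontier.exists_siblings {P : Finset (Vertex m)} (hP : Frontier P) (hr : root m ∉ P) :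
    ∃ v ∈ P, v ≠ root m ∧ sib v ∈ P := by
  have hne : P.Nonempty := by
    obtain ⟨l, -⟩ := exists_leaf_suffix (root m)
    obtain ⟨v, hv, -⟩ := hP.cover l
    exact ⟨v, hv⟩
  obtain ⟨v, hv, hmax⟩ := P.exists_max_image (fun v => v.1.length) hne
  have hvr : v ≠ root m := fun h => hr (h ▸ hv)
  refine ⟨v, hv, hvr, ?_⟩
  obtain ⟨b, p, h, rfl⟩ := vertex_ne_root_iff.1 hvr
  -- The member above a leaf below the sibling cannot be deeper than the sibling, by maximality, nor
  -- strictly above it, since it would then lie above `v` too.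
  obtain ⟨l, hl⟩ := exists_leaf_suffix (sib (⟨b :: p, h⟩ : Vertex m))
  obtain ⟨u, hu, hul⟩ := hP.cover l
  have hlen := hmax u hu
  rcases List.suffix_or_suffix_of_suffix hul hl with h1 | h1
  · rcases List.suffix_cons_iff.1 h1 with h2 | h2
    · have : u = sib ⟨b :: p, h⟩ := Subtype.ext h2
      rwa [← this]
    · have := hP.antichain u hu _ hv (h2.trans (List.suffix_cons _ _))
      subst this
      exact absurd h2 (not_cons_suffix_self b p)
  · have h3 := h1.eq_of_length_le (by simpa [sib] using hlen)
    have : u = sib ⟨b :: p, h⟩ := Subtype.ext h3.symm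
    rwa [← this]

end Frontier

/-! ### One round in one tree -/

section Round

variable {X : Type*} {m : ℕ} (A : Learner X) (pick : Sample X → Sample X → X)
  (guess : Vertex m → Bool)

theorem mem_merge_pertinent {st : TreeState X m} {v u : Vertex m} :
    u ∈ (merge A pick guess st v).pertinent ↔
      u = parent v ∨ (u ≠ sib v ∧ u ≠ v ∧ u ∈ st.pertinent) := by
  simp [merge]

theorem Clash.ne_root {A : Learner X} {st : TreeState X m} {v : Vertex m} (h : Clash A st v) :
    v ≠ root m := by
  rintro rfl
  exact h.1 rfl

theorem parent_suffix (v : Vertex m) : (parent v).1 <:+ v.1 := by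
  obtain ⟨l, h⟩ := v
  cases l with
  | nil => exact List.suffix_refl _
  | cons b p => exact List.suffix_cons _ _

theorem parent_sib (v : Vertex m) : parent (sib v) = parent v := by
  obtain ⟨l, h⟩ := v
  cases l <;> rfl

theorem covered_merge {st : TreeState X m} {v u : Vertex m} (hu : Covered st.pertinent u) :
    Covered (merge A pick guess st v).pertinent u := by
  obtain ⟨w, hw, hwu⟩ := hu
  by_cases h1 : w = v
  · subst h1
    exact ⟨parent w, by simp [mem_merge_pertinent], (parent_suffix w).trans hwu⟩
  by_cases h2 : w = sib v
  · subst h2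
    exact ⟨parent v, by simp [mem_merge_pertinent],
      (parent_sib v ▸ parent_suffix (sib v)).trans hwu⟩
  exact ⟨w, by simp [mem_merge_pertinent, *], hwu⟩

theorem frontier_merge {st : TreeState X m} {v : Vertex m} (hc : Clash A st v)
    (hP : Frontier st.pertinent) : Frontier (merge A pick guess st v).pertinent where
  cover l := covered_merge A pick guess (hP.cover l)
  antichain := by
    have key : ∀ u ∈ st.pertinent, u ≠ sib v → u ≠ v →
        ¬ u.1 <:+ (parent v).1 ∧ ¬ (parent v).1 <:+ u.1 := by
      intro u hu h1 h2
      obtain ⟨b, p, h, rfl⟩ := vertex_ne_root_iff.1 hc.ne_root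
      constructor
      · intro h3
        exact h2 (hP.antichain u hu _ hc.2.1 (h3.trans (parent_suffix _)))
      · intro h3
        have hne : p ≠ u.1 := by
          intro h4
          refine h2 (hP.antichain u hu _ hc.2.1 ?_)
          rw [← h4]; exact List.suffix_cons _ _
        obtain ⟨c, hc'⟩ := exists_cons_suffix h3 hne
        by_cases hcb : c = b
        · subst hcb
          exact h2 (hP.antichain _ hc.2.1 u hu hc').symm
        · have : c = !b := by cases b <;> cases c <;> simp_all
          subst this
          exact h1 (hP.antichain _ hc.2.2 u hu hc').symm
    intro u hu w hw huw
    rw [mem_merge_pertinent] at hu hw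
    rcases hu with rfl | ⟨hu1, hu2, hu3⟩ <;> rcases hw with rfl | ⟨hw1, hw2, hw3⟩
    · rfl
    · exact absurd huw (key w hw3 hw1 hw2).2
    · exact absurd huw (key u hu3 hu1 hu2).1
    · exact hP.antichain u hu3 w hw3 huw

theorem whileLoop_induction {Q : TreeState X m → Prop}
    (hQ : ∀ st v, Clash A st v → Q st → Q (merge A pick guess st v))
    (l : List Bool) (hl : l.length ≤ m) (st : TreeState X m) (h : Q st) :
    Q (whileLoop A pick guess l hl st) := by
  induction l generalizing st with
  | nil => exact h
  | cons b p ih =>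
    rw [whileLoop]
    split_ifs with hc
    · exact ih _ _ (hQ _ _ hc h)
    · exact h

theorem frontier_whileLoop (l : List Bool) (hl : l.length ≤ m) (st : TreeState X m)
    (h : Frontier st.pertinent) : Frontier (whileLoop A pick guess l hl st).pertinent :=
  whileLoop_induction A pick guess (Q := fun st => Frontier st.pertinent)
    (fun _ _ hc h => frontier_merge A pick guess hc h) l hl st h

theorem covered_whileLoop (l : List Bool) (hl : l.length ≤ m) (st : TreeState X m) {u : Vertex m}
    (h : Covered st.pertinent u) : Covered (whileLoop A pick guess l hl st).pertinent u :=
  whileLoop_induction A pick guess (Q := fun st => Covered st.pertinent u)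
    (fun _ _ _ h => covered_merge A pick guess h) l hl st h

/-- Append the example to the sample of the vertex. -/
def addExample (st : TreeState X m) (v : Vertex m) (z : X × Bool) : TreeState X m :=
  { st with sample := Function.update st.sample v ((st.sample v).map (· ++ [z])) }

variable {A pick guess} in
/-- Case analysis for one round: nothing happens, or an example is appended without a merge, or
the while loop is executed. -/
theorem treeRound_cases {ρ : Chooser m} {l : Leaf m} {z : X × Bool} {st : TreeState X m}
    (hP : Frontier st.pertinent) :
    (root m ∈ st.pertinent ∧ treeRound A pick guess ρ l z st = st) ∨
    ∃ v ∈ st.pertinent, v.1 <:+ l.1 ∧ v ≠ root m ∧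
      ((¬ Clash A (addExample st v z) v ∧
          treeRound A pick guess ρ l z st = addExample st v z) ∨
        (Clash A (addExample st v z) v ∧ treeRound A pick guess ρ l z st =
          reselect A ρ (whileLoop A pick guess v.1 v.2 (addExample st v z)))) := by
  obtain ⟨v, hv, hvP, hvl⟩ := hP.exists_antecedent l
  unfold treeRound
  rw [hv]
  by_cases h : v = root m
  · left
    simp only [h, if_true]
    exact ⟨h ▸ hvP, trivial⟩
  · right
    refine ⟨v, hvP, hvl, h, ?_⟩
    by_cases hc : Clash A (addExample st v z) v
    · right
      refine ⟨hc, ?_⟩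
      simp only [h, if_false]
      exact if_pos hc
    · left
      refine ⟨hc, ?_⟩
      simp only [h, if_false]
      exact if_neg hc

theorem reselect_cases (ρ : Chooser m) (st : TreeState X m) :
    (∃ h : (collisions A st).Nonempty,
      reselect A ρ st = { st with out := (ρ ⟨collisions A st, h⟩).1 }) ∨
    (collisions A st = ∅ ∧ reselect A ρ st =
      { pertinent := {root m}, sample := Function.update st.sample (root m) none,
        out := root m }) := by
  unfold reselect
  by_cases h : (collisions A st).Nonempty
  · left; exact ⟨h, by rw [dif_pos h]⟩
  · right; exact ⟨Finset.not_nonempty_iff_eq_empty.1 h, by rw [dif_neg h]⟩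

theorem frontier_reselect (ρ : Chooser m) (st : TreeState X m) (h : Frontier st.pertinent) :
    Frontier (reselect A ρ st).pertinent := by
  rcases reselect_cases A ρ st with ⟨_, h2⟩ | ⟨_, h2⟩ <;> rw [h2]
  · exact h
  · exact frontier_root

theorem covered_reselect (ρ : Chooser m) (st : TreeState X m) {u : Vertex m}
    (h : Covered st.pertinent u) : Covered (reselect A ρ st).pertinent u := by
  rcases reselect_cases A ρ st with ⟨_, h2⟩ | ⟨_, h2⟩ <;> rw [h2]
  · exact h
  · exact ⟨root m, by simp, List.nil_suffix⟩

theorem frontier_treeRound (ρ : Chooser m) (l : Leaf m) (z : X × Bool) {st : TreeState X m}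
    (h : Frontier st.pertinent) : Frontier (treeRound A pick guess ρ l z st).pertinent := by
  rcases treeRound_cases (A := A) (pick := pick) (guess := guess) (ρ := ρ) (l := l) (z := z) h with
    ⟨_, h1⟩ | ⟨v, _, _, _, ⟨_, h1⟩ | ⟨_, h1⟩⟩ <;> rw [h1]
  · exact h
  · exact h
  · exact frontier_reselect _ _ _ (frontier_whileLoop _ _ _ _ _ _ h)

theorem covered_treeRound (ρ : Chooser m) (l : Leaf m) (z : X × Bool) {st : TreeState X m}
    (h : Frontier st.pertinent) {u : Vertex m} (hu : Covered st.pertinent u) :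
    Covered (treeRound A pick guess ρ l z st).pertinent u := by
  rcases treeRound_cases (A := A) (pick := pick) (guess := guess) (ρ := ρ) (l := l) (z := z) h with
    ⟨_, h1⟩ | ⟨v, _, _, _, ⟨_, h1⟩ | ⟨_, h1⟩⟩ <;> rw [h1]
  · exact hu
  · exact hu
  · exact covered_reselect _ _ _ (covered_whileLoop _ _ _ _ _ _ hu)

end Round

/-! ### Restriction of a state to a subtree -/

section Locality

variable {X : Type*} {m : ℕ}

/-- The two states coincide on the subtree rooted at `a`. -/
def AgreeOn (a : Vertex m) (st st' : TreeState X m) : Prop :=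
  ∀ v : Vertex m, a.1 <:+ v.1 →
    (v ∈ st.pertinent ↔ v ∈ st'.pertinent) ∧ st.sample v = st'.sample v

theorem AgreeOn.refl (a : Vertex m) (st : TreeState X m) : AgreeOn a st st :=
  fun _ _ => ⟨Iff.rfl, rfl⟩

theorem AgreeOn.symm {a : Vertex m} {st st' : TreeState X m} (h : AgreeOn a st st') :
    AgreeOn a st' st :=
  fun v hv => ⟨(h v hv).1.symm, (h v hv).2.symm⟩

theorem AgreeOn.trans {a : Vertex m} {st st' st'' : TreeState X m} (h : AgreeOn a st st')
    (h' : AgreeOn a st' st'') : AgreeOn a st st'' :=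
  fun v hv => ⟨(h v hv).1.trans (h' v hv).1, (h v hv).2.trans (h' v hv).2⟩

variable {A : Learner X} {pick : Sample X → Sample X → X} {g g' : Vertex m → Bool}

theorem AgreeOn.predictor_eq {a : Vertex m} {st st' : TreeState X m} (h : AgreeOn a st st')
    {v : Vertex m} (hv : a.1 <:+ v.1) : predictor A st v = predictor A st' v := by
  unfold predictor
  rw [(h v hv).2]

theorem AgreeOn.clash_iff {a : Vertex m} {st st' : TreeState X m} (h : AgreeOn a st st')
    {v : Vertex m} (hv : a.1 <:+ v.1) (hv' : a.1 <:+ (sib v).1) :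
    Clash A st v ↔ Clash A st' v := by
  unfold Clash
  rw [h.predictor_eq hv, h.predictor_eq hv', (h v hv).1, (h _ hv').1]

theorem AgreeOn.merge {a : Vertex m} {st st' : TreeState X m} (h : AgreeOn a st st')
    {v : Vertex m} (hv : a.1 <:+ v.1) (hv' : a.1 <:+ (sib v).1) (hg : g (parent v) = g' (parent v)) :
    AgreeOn a (merge A pick g st v) (merge A pick g' st' v) := by
  intro u hu
  constructor
  · rw [mem_merge_pertinent, mem_merge_pertinent, (h u hu).1]
  · simp only [DPSOA.merge, Function.update_apply]
    rw [(h v hv).2, (h _ hv').2, (h u hu).2, hg]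

theorem agreeOn_merge_outside {a v : Vertex m} {st : TreeState X m} (hv : ¬ a.1 <:+ v.1)
    (hv' : ¬ a.1 <:+ (sib v).1) : AgreeOn a st (merge A pick g st v) := by
  intro u hu
  have h1 : u ≠ v := fun h => hv (h ▸ hu)
  have h2 : u ≠ sib v := fun h => hv' (h ▸ hu)
  have h3 : u ≠ parent v := fun h => hv ((h ▸ hu).trans (parent_suffix v))
  constructor
  · simp [mem_merge_pertinent, h1, h2, h3]
  · simp [DPSOA.merge, h3]

theorem covered_parent_of_merge {l : List Bool} {hl : l.length ≤ m} {st : TreeState X m}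
    {v : Vertex m} : Covered (whileLoop A pick g l hl (merge A pick g st v)).pertinent (parent v) :=
  covered_whileLoop _ _ _ _ _ _ ⟨parent v, by simp [mem_merge_pertinent], List.suffix_refl _⟩

/-- A loop started outside the subtree at `a` climbs away from it. It could touch the subtree only
by merging `a` with its sibling, which would cover the parent of `a`. -/
theorem agreeOn_whileLoop_outside {a : Vertex m} {l : List Bool} (hl : l.length ≤ m)
    {st : TreeState X m} (ha : ¬ a.1 <:+ l)
    (hc : ¬ Covered (whileLoop A pick g l hl st).pertinent (parent a)) :
    AgreeOn a st (whileLoop A pick g l hl st) := by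
  induction l generalizing st with
  | nil => exact AgreeOn.refl _ _
  | cons b p ih =>
    rw [whileLoop] at hc ⊢
    split_ifs at hc ⊢ with h
    · have hp : ¬ a.1 <:+ p := fun h' => ha (h'.trans (List.suffix_cons _ _))
      refine AgreeOn.trans (agreeOn_merge_outside ha ?_) (ih _ hp hc)
      intro h'
      rcases List.suffix_cons_iff.1 h' with h2 | h2
      · have h3 : a = sib ⟨b :: p, hl⟩ := Subtype.ext h2
        apply hc
        rw [h3, parent_sib]
        exact covered_parent_of_merge
      · exact hp h2
    · exact AgreeOn.refl _ _

theorem AgreeOn.whileLoop {a : Vertex m} {l : List Bool} (hl : l.length ≤ m)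
    {st st' : TreeState X m} (h : AgreeOn a st st') (ha : a.1 <:+ l)
    (hg : ∀ v : Vertex m, a.1 <:+ v.1 → g v = g' v)
    (hc : ¬ Covered (whileLoop A pick g l hl st).pertinent (parent a))
    (hc' : ¬ Covered (DPSOA.whileLoop A pick g' l hl st').pertinent (parent a)) :
    AgreeOn a (DPSOA.whileLoop A pick g l hl st) (DPSOA.whileLoop A pick g' l hl st') := by
  induction l generalizing st st' with
  | nil => exact h
  | cons b p ih =>
    rcases List.suffix_cons_iff.1 ha with h1 | h1
    · have h2 : a = ⟨b :: p, hl⟩ := Subtype.ext h1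
      rw [DPSOA.whileLoop] at hc hc' ⊢
      rw [DPSOA.whileLoop]
      have n1 : ¬ Clash A st ⟨b :: p, hl⟩ := by
        intro n
        rw [if_pos n, h2] at hc
        exact hc covered_parent_of_merge
      have n2 : ¬ Clash A st' ⟨b :: p, hl⟩ := by
        intro n
        rw [if_pos n, h2] at hc'
        exact hc' covered_parent_of_merge
      rw [if_neg n1, if_neg n2]
      exact h
    · have hs : a.1 <:+ (sib (⟨b :: p, hl⟩ : Vertex m)).1 := h1.trans (List.suffix_cons _ _)
      have hiff := h.clash_iff (A := A) (v := ⟨b :: p, hl⟩) ha hs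
      rw [DPSOA.whileLoop] at hc hc' ⊢
      rw [DPSOA.whileLoop]
      by_cases n : Clash A st ⟨b :: p, hl⟩
      · rw [if_pos n] at hc ⊢
        rw [if_pos (hiff.1 n)] at hc' ⊢
        exact ih _ (h.merge ha hs (hg _ h1)) h1 hc hc'
      · rw [if_neg n, if_neg (fun n' => n (hiff.2 n'))]
        exact h

/-- The branch without candidates makes the root pertinent, which covers every vertex. A vertex that
is still uncovered therefore shows that only the output vertex was changed. -/
theorem reselect_eq_of_not_covered {ρ : Chooser m} {st : TreeState X m} {u : Vertex m}
    (hc : ¬ Covered (reselect A ρ st).pertinent u) :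
    (reselect A ρ st).pertinent = st.pertinent ∧ (reselect A ρ st).sample = st.sample := by
  rcases reselect_cases A ρ st with ⟨_, h2⟩ | ⟨_, h2⟩
  · rw [h2]; exact ⟨rfl, rfl⟩
  · rw [h2] at hc
    exact absurd ⟨root m, by simp, List.nil_suffix⟩ hc

theorem AgreeOn.of_eq {a : Vertex m} {st st' : TreeState X m}
    (h : st'.pertinent = st.pertinent ∧ st'.sample = st.sample) : AgreeOn a st st' :=
  fun v _ => ⟨by rw [h.1], by rw [h.2]⟩

theorem agreeOn_addExample_outside {a v : Vertex m} {st : TreeState X m} {z : X × Bool}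
    (hv : ¬ a.1 <:+ v.1) : AgreeOn a st (addExample st v z) := by
  intro u hu
  have h1 : u ≠ v := fun h => hv (h ▸ hu)
  exact ⟨Iff.rfl, by simp [addExample, h1]⟩

theorem AgreeOn.addExample {a : Vertex m} {st st' : TreeState X m} (h : AgreeOn a st st')
    {v : Vertex m} (hv : a.1 <:+ v.1) (z : X × Bool) :
    AgreeOn a (DPSOA.addExample st v z) (DPSOA.addExample st' v z) := by
  intro u hu
  refine ⟨(h u hu).1, ?_⟩
  simp only [DPSOA.addExample, Function.update_apply]
  rw [(h v hv).2, (h u hu).2]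

theorem agreeOn_treeRound_outside {a : Vertex m} {ρ : Chooser m} {l : Leaf m} {z : X × Bool}
    {st : TreeState X m} (hP : Frontier st.pertinent) (ha : ¬ a.1 <:+ l.1)
    (hc : ¬ Covered (treeRound A pick g ρ l z st).pertinent (parent a)) :
    AgreeOn a st (treeRound A pick g ρ l z st) := by
  rcases treeRound_cases (A := A) (pick := pick) (guess := g) (ρ := ρ) (l := l) (z := z) hP with
    ⟨_, h1⟩ | ⟨v, _, hvl, _, ⟨_, h1⟩ | ⟨_, h1⟩⟩ <;> rw [h1] at hc ⊢
  · exact AgreeOn.refl _ _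
  · exact agreeOn_addExample_outside (fun h => ha (h.trans hvl))
  · have hav : ¬ a.1 <:+ v.1 := fun h => ha (h.trans hvl)
    have h3 := reselect_eq_of_not_covered hc
    rw [h3.1] at hc
    exact ((agreeOn_addExample_outside hav).trans (agreeOn_whileLoop_outside _ hav hc)).trans
      (AgreeOn.of_eq h3)

theorem treeRound_of_mem {ρ : Chooser m} {l : Leaf m} {z : X × Bool} {st : TreeState X m}
    (hP : Frontier st.pertinent) {v : Vertex m} (hv : v ∈ st.pertinent) (hvl : v.1 <:+ l.1)
    (hvr : v ≠ root m) :
    (¬ Clash A (addExample st v z) v ∧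
          treeRound A pick g ρ l z st = addExample st v z) ∨
        (Clash A (addExample st v z) v ∧ treeRound A pick g ρ l z st =
          reselect A ρ (whileLoop A pick g v.1 v.2 (addExample st v z))) := by
  rcases treeRound_cases (A := A) (pick := pick) (guess := g) (ρ := ρ) (l := l) (z := z) hP with
    ⟨h, _⟩ | ⟨u, hu, hul, _, h⟩
  · exact absurd (hP.antichain _ h v hv List.nil_suffix).symm hvr
  · rw [hP.eq_of_suffix hu hv hul hvl] at h
    exact h

theorem AgreeOn.treeRound {a : Vertex m} (har : a ≠ root m) {ρ ρ' : Chooser m} {l : Leaf m}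
    {z : X × Bool} {st st' : TreeState X m} (hP : Frontier st.pertinent)
    (hP' : Frontier st'.pertinent) (h : AgreeOn a st st') (ha : a.1 <:+ l.1)
    (hg : ∀ v : Vertex m, a.1 <:+ v.1 → g v = g' v)
    (hc : ¬ Covered (treeRound A pick g ρ l z st).pertinent (parent a))
    (hc' : ¬ Covered (DPSOA.treeRound A pick g' ρ' l z st').pertinent (parent a)) :
    AgreeOn a (DPSOA.treeRound A pick g ρ l z st) (DPSOA.treeRound A pick g' ρ' l z st') := by
  obtain ⟨v, hvP, hvl⟩ := hP.cover l
  -- A pertinent vertex strictly above `a` would cover the parent of `a`, so the antecedent of the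
  -- leaf lies in the subtree at `a`, where the two states agree.
  have hav : a.1 <:+ v.1 := by
    rcases List.suffix_or_suffix_of_suffix ha hvl with h1 | h1
    · exact h1
    · by_cases hne : v = a
      · rw [hne]
      · refine absurd (covered_treeRound A pick g ρ l z hP (u := parent a) ?_) hc
        refine ⟨v, hvP, ?_⟩
        obtain ⟨b, p, hbp, rfl⟩ := vertex_ne_root_iff.1 har
        rcases List.suffix_cons_iff.1 h1 with h2 | h2
        · exact absurd (Subtype.ext h2) hne
        · exact h2
  have hvr : v ≠ root m := by
    rintro rfl
    exact har (Subtype.ext (List.eq_nil_of_suffix_nil hav))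
  have hst := h.addExample hav z
  -- On the subtree, a whole round amounts to the while loop. This is used for each of the two
  -- states, and if no merge occurs the loop stops immediately.
  have loc : ∀ {g : Vertex m → Bool} {ρ : Chooser m} {st : TreeState X m},
      Frontier st.pertinent → v ∈ st.pertinent →
      ¬ Covered (DPSOA.treeRound A pick g ρ l z st).pertinent (parent a) →
      ¬ Covered (DPSOA.whileLoop A pick g v.1 v.2 (DPSOA.addExample st v z)).pertinent (parent a) ∧
      AgreeOn a (DPSOA.whileLoop A pick g v.1 v.2 (DPSOA.addExample st v z))
        (DPSOA.treeRound A pick g ρ l z st) := by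
    intro g ρ st hP hvP hc
    rcases treeRound_of_mem (A := A) (pick := pick) (g := g) (ρ := ρ) (z := z) hP hvP hvl hvr with
      ⟨hn, h1⟩ | ⟨hn, h1⟩ <;> rw [h1] at hc ⊢
    · obtain ⟨b, p, hbp, rfl⟩ := vertex_ne_root_iff.1 hvr
      rw [DPSOA.whileLoop, if_neg hn]
      exact ⟨hc, AgreeOn.refl _ _⟩
    · have h3 := reselect_eq_of_not_covered hc
      rw [h3.1] at hc
      exact ⟨hc, AgreeOn.of_eq h3⟩
  obtain ⟨c1, e1⟩ := loc hP hvP hc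
  obtain ⟨c2, e2⟩ := loc hP' ((h v hav).1.1 hvP) hc'
  exact (e1.symm.trans (hst.whileLoop v.2 hav hg c1 c2)).trans e2

end Locality

/-! ### Dependence on the guesses and on the random choices -/

section Dependence

variable {X : Type*} {m : ℕ} {A : Learner X} {pick : Sample X → Sample X → X}
  {g g' : Vertex m → Bool}

theorem merge_congr_guess {st : TreeState X m} {v : Vertex m} (h : g (parent v) = g' (parent v)) :
    merge A pick g st v = merge A pick g' st v := by
  unfold merge
  rw [h]

/-- The loop reads a guess only at a parent that it creates, and that parent stays covered
afterwards. -/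
theorem whileLoop_congr_guess {l : List Bool} {hl : l.length ≤ m} {st : TreeState X m}
    (h : ∀ u : Vertex m, u.1 <:+ l → u.1 ≠ l →
      Covered (whileLoop A pick g l hl st).pertinent u → g u = g' u) :
    whileLoop A pick g l hl st = whileLoop A pick g' l hl st := by
  induction l generalizing st with
  | nil => rfl
  | cons b p ih =>
    rw [whileLoop] at h ⊢
    rw [whileLoop]
    split_ifs at h ⊢ with hc
    · have hp : g (parent ⟨b :: p, hl⟩) = g' (parent ⟨b :: p, hl⟩) :=
        h _ (parent_suffix _) (by simp [parent]) covered_parent_of_merge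
      rw [← merge_congr_guess (g := g) (g' := g') hp]
      refine ih fun u hu hne hcov => h u (hu.trans (List.suffix_cons _ _)) ?_ hcov
      intro h'
      rw [h'] at hu
      exact not_cons_suffix_self _ _ hu
    · rfl

theorem treeRound_congr_guess {ρ : Chooser m} {l : Leaf m} {z : X × Bool} {st : TreeState X m}
    (hP : Frontier st.pertinent)
    (h : ∀ u : Vertex m, u.1.length < m →
      Covered (treeRound A pick g ρ l z st).pertinent u → g u = g' u) :
    treeRound A pick g ρ l z st = treeRound A pick g' ρ l z st := by
  rcases treeRound_cases (A := A) (pick := pick) (guess := g) (ρ := ρ) (l := l) (z := z) hP with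
    ⟨hr, h1⟩ | ⟨v, hvP, hvl, hvr, h1⟩
  · rw [h1]
    rcases treeRound_cases (A := A) (pick := pick) (guess := g') (ρ := ρ) (l := l) (z := z) hP with
      ⟨_, h2⟩ | ⟨v, hvP, hvl, hvr, h2⟩
    · rw [h2]
    · exact absurd (hP.antichain _ hr v hvP List.nil_suffix).symm hvr
  · have h2 := treeRound_of_mem (A := A) (pick := pick) (g := g') (ρ := ρ) (z := z) hP hvP hvl hvr
    rcases h1 with ⟨n1, h1⟩ | ⟨n1, h1⟩ <;> rcases h2 with ⟨n2, h2⟩ | ⟨n2, h2⟩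
    · rw [h1, h2]
    · exact absurd n2 n1
    · exact absurd n1 n2
    · rw [h1] at h
      rw [h1, h2]
      congr 1
      refine whileLoop_congr_guess fun u hu hne hcov => h u ?_ (covered_reselect _ _ _ hcov)
      have h3 := hu.length_le
      have h4 : u.1.length ≠ v.1.length := fun h5 => hne (hu.eq_of_length h5)
      have := v.2
      omega

theorem whileLoop_out (l : List Bool) (hl : l.length ≤ m) (st : TreeState X m) (o : Vertex m) :
    whileLoop A pick g l hl { st with out := o } =
      { whileLoop A pick g l hl st with out := o } := by
  induction l generalizing st with
  | nil => rfl
  | cons b p ih =>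
    rw [whileLoop, whileLoop]
    have : Clash A { st with out := o } ⟨b :: p, hl⟩ ↔ Clash A st ⟨b :: p, hl⟩ := Iff.rfl
    by_cases hc : Clash A st ⟨b :: p, hl⟩
    · rw [if_pos (this.2 hc), if_pos hc]
      exact ih _ (merge A pick g st ⟨b :: p, hl⟩)
    · rw [if_neg (fun h => hc (this.1 h)), if_neg hc]

theorem collisions_out (st : TreeState X m) (o : Vertex m) :
    collisions A { st with out := o } = collisions A st := rfl

/-- The pertinent vertices and the samples do not depend on the random choices. -/
theorem treeRound_core (ρ ρ' : Chooser m) {l : Leaf m} {z : X × Bool} {st st' : TreeState X m}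
    (hP : Frontier st.pertinent)
    (h : st'.pertinent = st.pertinent ∧ st'.sample = st.sample) :
    (treeRound A pick g ρ' l z st').pertinent = (treeRound A pick g ρ l z st).pertinent ∧
    (treeRound A pick g ρ' l z st').sample = (treeRound A pick g ρ l z st).sample := by
  obtain ⟨o, rfl⟩ : ∃ o, st' = { st with out := o } := by
    obtain ⟨P, S, o⟩ := st'
    obtain ⟨P', S', o'⟩ := st
    obtain ⟨rfl, rfl⟩ := h
    exact ⟨o, rfl⟩
  have hP' : Frontier ({ st with out := o } : TreeState X m).pertinent := hP
  rcases treeRound_cases (A := A) (pick := pick) (guess := g) (ρ := ρ) (l := l) (z := z) hP with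
    ⟨hr, h1⟩ | ⟨v, hvP, hvl, hvr, h1⟩
  · rcases treeRound_cases (A := A) (pick := pick) (guess := g) (ρ := ρ') (l := l) (z := z) hP' with
      ⟨_, h2⟩ | ⟨v, hvP, hvl, hvr, h2⟩
    · rw [h1, h2]; exact h
    · exact absurd (hP.antichain _ hr v hvP List.nil_suffix).symm hvr
  · have h2 := treeRound_of_mem (A := A) (pick := pick) (g := g) (ρ := ρ') (z := z) hP' hvP hvl hvr
    rcases h1 with ⟨n1, h1⟩ | ⟨n1, h1⟩ <;> rcases h2 with ⟨n2, h2⟩ | ⟨n2, h2⟩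
    · rw [h1, h2]; exact ⟨rfl, rfl⟩
    · exact absurd n2 n1
    · exact absurd n1 n2
    · rw [h1, h2]
      have h3 : addExample { st with out := o } v z = { addExample st v z with out := o } := rfl
      rw [h3, whileLoop_out]
      generalize whileLoop A pick g v.1 v.2 (addExample st v z) = s
      rcases reselect_cases A ρ s with ⟨hn, h4⟩ | ⟨hn, h4⟩ <;>
        rcases reselect_cases A ρ' { s with out := o } with ⟨hn', h5⟩ | ⟨hn', h5⟩ <;> rw [h4, h5]
      · exact ⟨rfl, rfl⟩
      · rw [collisions_out] at hn'
        exact absurd hn' hn.ne_empty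
      · rw [collisions_out] at hn'
        exact absurd hn hn'.ne_empty
      · exact ⟨rfl, rfl⟩

end Dependence

/-! ### Absence of clashes at the end of a round -/

section NoClash

variable {X : Type*} {m : ℕ} {A : Learner X} {pick : Sample X → Sample X → X}
  {g : Vertex m → Bool}

theorem Clash.sib {st : TreeState X m} {v : Vertex m} (h : Clash A st v) : Clash A st (sib v) :=
  ⟨by rw [sib_sib]; exact h.1.symm, h.2.2, by rw [sib_sib]; exact h.2.1⟩

theorem clash_addExample {st : TreeState X m} {v u : Vertex m} {z : X × Bool}
    (hst : ∀ u, ¬ Clash A st u) (h : Clash A (addExample st v z) u) : u = v ∨ sib u = v := by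
  by_contra! hne
  refine hst u ⟨?_, h.2.1, h.2.2⟩
  have := h.1
  simpa [predictor, addExample, hne.1, hne.2] using this

/-- The only possible clash moves up with the loop: a merge removes the old pair and changes the
sample only at the parent. Hence the loop ends without clashes. -/
theorem clash_merge {st : TreeState X m} {v u : Vertex m}
    (hst : ∀ u, Clash A st u → u = v ∨ DPSOA.sib u = v) (h : Clash A (merge A pick g st v) u) :
    u = parent v ∨ DPSOA.sib u = parent v := by
  by_contra! hne
  obtain ⟨h1, h2, h3⟩ := h
  rw [mem_merge_pertinent] at h2 h3
  have h2 := h2.resolve_left hne.1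
  have h3 := h3.resolve_left hne.2
  have h1 : predictor A st u ≠ predictor A st (DPSOA.sib u) := by
    simpa [predictor, merge, hne.1, hne.2] using h1
  rcases hst u ⟨h1, h2.2.2, h3.2.2⟩ with h4 | h4
  · exact h2.2.1 h4
  · exact h3.2.1 h4

theorem not_clash_whileLoop (v : Vertex m) {st : TreeState X m}
    (hst : ∀ u, Clash A st u → u = v ∨ DPSOA.sib u = v) (u : Vertex m) :
    ¬ Clash A (whileLoop A pick g v.1 v.2 st) u := by
  obtain ⟨l, hl⟩ := v
  induction l generalizing st with
  | nil =>
    rw [whileLoop]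
    intro h
    rcases hst u h with h1 | h1
    · exact h.ne_root h1
    · exact h.sib.ne_root h1
  | cons b p ih =>
    simp only at ih ⊢
    rw [whileLoop]
    split_ifs with hc
    · exact ih _ fun u hu => clash_merge (pick := pick) (g := g) hst hu
    · intro h
      rcases hst u h with h1 | h1
      · exact hc (h1 ▸ h)
      · exact hc (h1 ▸ h.sib)

theorem not_clash_reselect {ρ : Chooser m} {st : TreeState X m} (hst : ∀ u, ¬ Clash A st u)
    (u : Vertex m) : ¬ Clash A (reselect A ρ st) u := by
  rcases reselect_cases A ρ st with ⟨_, h2⟩ | ⟨_, h2⟩ <;> rw [h2]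
  · exact hst u
  · intro h
    exact h.ne_root (by simpa using h.2.1)

theorem not_clash_treeRound {ρ : Chooser m} {l : Leaf m} {z : X × Bool} {st : TreeState X m}
    (hP : Frontier st.pertinent) (hst : ∀ u, ¬ Clash A st u) (u : Vertex m) :
    ¬ Clash A (treeRound A pick g ρ l z st) u := by
  rcases treeRound_cases (A := A) (pick := pick) (guess := g) (ρ := ρ) (l := l) (z := z) hP with
    ⟨_, h1⟩ | ⟨v, _, _, _, ⟨hc, h1⟩ | ⟨_, h1⟩⟩ <;> rw [h1]
  · exact hst u
  · intro h
    rcases clash_addExample hst h with h2 | h2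
    · exact hc (h2 ▸ h)
    · exact hc (h2 ▸ h.sib)
  · exact not_clash_reselect (not_clash_whileLoop v fun u hu => clash_addExample hst hu) u

theorem not_clash_initTree (v₀ : Leaf m) (u : Vertex m) :
    ¬ Clash A (initTree (X := X) v₀) u := by
  rintro ⟨h1, h2, h3⟩
  simp only [initTree, Finset.mem_filter, Finset.mem_univ, true_and] at h2 h3
  apply h1
  simp [predictor, initTree, h2, h3]

/-- Without clashes the equality of predictors is automatic, so the candidates are determined by the
pertinent set alone and remain the same until the next merge. -/
theorem mem_collisions {st : TreeState X m} (hst : ∀ u, ¬ Clash A st u) {v : Vertex m} :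
    v ∈ collisions A st ↔ v ≠ root m ∧ v ∈ st.pertinent ∧ DPSOA.sib v ∈ st.pertinent := by
  simp only [collisions, Finset.mem_filter]
  constructor
  · rintro ⟨h1, h2, h3, -⟩
    exact ⟨h2, h1, h3⟩
  · rintro ⟨h1, h2, h3⟩
    refine ⟨h2, h1, h3, ?_⟩
    by_contra h
    exact hst v ⟨h, h2, h3⟩

end NoClash

/-! ### Mistakes -/

theorem mistakes_eq_sum {X : Type*} (A : Learner X) (S : Sample X) :
    mistakes A S = ∑ j ∈ Finset.range S.length,
      if ∃ z, S[j]? = some z ∧ A (S.take j) z.1 ≠ z.2 then 1 else 0 := by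
  classical
  rw [Finset.sum_range, mistakes, Finset.card_filter]
  refine Finset.sum_congr rfl fun j _ => ?_
  simp

theorem mistakes_append_singleton {X : Type*} (A : Learner X) (S : Sample X) (z : X × Bool) :
    mistakes A (S ++ [z]) = mistakes A S + if A S z.1 ≠ z.2 then 1 else 0 := by
  classical
  rw [mistakes_eq_sum, mistakes_eq_sum, List.length_append, List.length_singleton,
    Finset.sum_range_succ]
  congr 1
  · refine Finset.sum_congr rfl fun j hj => ?_
    have hj' := Finset.mem_range.1 hj
    rw [List.getElem?_append_left hj', List.take_append_of_le_length hj'.le]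
  · simp

/-! ### The run of one tree -/

section Run

variable {X : Type*} {T m : ℕ}

/-- The state of a single tree after `n` rounds, when the example of round `t` is assigned to the
leaf `w t`, or to another tree if `w t = none`. -/
noncomputable def treeRun (A : Learner X) (pick : Fin T → Sample X → Sample X → X)
    (data : Fin T → X × Bool) (g : Vertex m → Bool) (ρ : Fin T → Chooser m) (v₀ : Leaf m)
    (w : Fin T → Option (Leaf m)) : ℕ → TreeState X m
  | 0 => initTree v₀
  | n + 1 =>
      if h : n < T then
        (w ⟨n, h⟩).elim (treeRun A pick data g ρ v₀ w n) fun l =>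
          treeRound A (pick ⟨n, h⟩) g (ρ ⟨n, h⟩) l (data ⟨n, h⟩) (treeRun A pick data g ρ v₀ w n)
      else treeRun A pick data g ρ v₀ w n

variable {A : Learner X} {pick : Fin T → Sample X → Sample X → X} {data : Fin T → X × Bool}
  {g g' : Vertex m → Bool} {ρ ρ' : Fin T → Chooser m} {v₀ v₀' : Leaf m}
  {w w' : Fin T → Option (Leaf m)}

/-- In every round either the tree does not change, or it executes `treeRound`. -/
theorem treeRun_succ (n : ℕ) :
    ((∀ h : n < T, w ⟨n, h⟩ = none) ∧ ∀ (g : Vertex m → Bool) (ρ : Fin T → Chooser m) (v₀ : Leaf m),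
      treeRun A pick data g ρ v₀ w (n + 1) = treeRun A pick data g ρ v₀ w n) ∨
    ∃ (h : n < T) (l : Leaf m), w ⟨n, h⟩ = some l ∧
      ∀ (g : Vertex m → Bool) (ρ : Fin T → Chooser m) (v₀ : Leaf m),
        treeRun A pick data g ρ v₀ w (n + 1) =
          treeRound A (pick ⟨n, h⟩) g (ρ ⟨n, h⟩) l (data ⟨n, h⟩) (treeRun A pick data g ρ v₀ w n) := by
  by_cases h : n < T
  · rcases hw : w ⟨n, h⟩ with _ | l
    · left
      refine ⟨fun _ => hw, fun g ρ v₀ => ?_⟩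
      rw [treeRun, dif_pos h, hw]; rfl
    · right
      refine ⟨h, l, hw, fun g ρ v₀ => ?_⟩
      rw [treeRun, dif_pos h, hw]; rfl
  · left
    refine ⟨fun h' => absurd h' h, fun g ρ v₀ => ?_⟩
    rw [treeRun, dif_neg h]

theorem frontier_treeRun (n : ℕ) : Frontier (treeRun A pick data g ρ v₀ w n).pertinent := by
  induction n with
  | zero => exact frontier_initTree v₀
  | succ n ih =>
    rcases treeRun_succ (A := A) (pick := pick) (data := data) (w := w) n with
      ⟨_, h⟩ | ⟨_, l, _, h⟩ <;> rw [h]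
    · exact ih
    · exact frontier_treeRound _ _ _ _ _ _ ih

/-- Coverage is never lost. Thus a vertex uncovered after some round was uncovered after all earlier
ones, which is what the inductions on the number of rounds need. -/
theorem covered_treeRun_succ {n : ℕ} {u : Vertex m}
    (hu : Covered (treeRun A pick data g ρ v₀ w n).pertinent u) :
    Covered (treeRun A pick data g ρ v₀ w (n + 1)).pertinent u := by
  rcases treeRun_succ (A := A) (pick := pick) (data := data) (w := w) n with
    ⟨_, h⟩ | ⟨_, l, _, h⟩ <;> rw [h]
  · exact hu
  · exact covered_treeRound _ _ _ _ _ _ (frontier_treeRun n) hu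

theorem not_clash_treeRun (n : ℕ) (u : Vertex m) :
    ¬ Clash A (treeRun A pick data g ρ v₀ w n) u := by
  induction n generalizing u with
  | zero => exact not_clash_initTree v₀ u
  | succ n ih =>
    rcases treeRun_succ (A := A) (pick := pick) (data := data) (w := w) n with
      ⟨_, h⟩ | ⟨_, l, _, h⟩ <;> rw [h]
    · exact ih u
    · exact not_clash_treeRound (frontier_treeRun n) ih u

/-- The state of a subtree depends only on the examples and the guesses of that subtree, as long as
its root has not been merged. -/
theorem agreeOn_treeRun {a : Vertex m} (ha : a ≠ root m)
    (hw : ∀ t (l : Leaf m), a.1 <:+ l.1 → (w t = some l ↔ w' t = some l))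
    (hg : ∀ v : Vertex m, a.1 <:+ v.1 → g v = g' v) (n : ℕ)
    (hc : ¬ Covered (treeRun A pick data g ρ v₀ w n).pertinent (parent a))
    (hc' : ¬ Covered (treeRun A pick data g' ρ' v₀' w' n).pertinent (parent a)) :
    AgreeOn a (treeRun A pick data g ρ v₀ w n) (treeRun A pick data g' ρ' v₀' w' n) := by
  induction n with
  | zero => exact fun v _ => ⟨Iff.rfl, rfl⟩
  | succ n ih =>
    have ih := ih (fun h => hc (covered_treeRun_succ h)) (fun h => hc' (covered_treeRun_succ h))
    -- Rounds whose example does not fall below `a` leave the subtree alone. The two runs need not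
    -- have the same idle rounds, so each is treated by itself.
    have out : ∀ {w : Fin T → Option (Leaf m)} {g : Vertex m → Bool} {ρ : Fin T → Chooser m}
        {v₀ : Leaf m}, (∀ (h : n < T) (l : Leaf m), w ⟨n, h⟩ = some l → ¬ a.1 <:+ l.1) →
        ¬ Covered (treeRun A pick data g ρ v₀ w (n + 1)).pertinent (parent a) →
        AgreeOn a (treeRun A pick data g ρ v₀ w n) (treeRun A pick data g ρ v₀ w (n + 1)) := by
      intro w g ρ v₀ hl hc
      rcases treeRun_succ (A := A) (pick := pick) (data := data) (w := w) n with
        ⟨_, h⟩ | ⟨hn, l, hwl, h⟩ <;> rw [h] at hc ⊢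
      · exact AgreeOn.refl _ _
      · exact agreeOn_treeRound_outside (frontier_treeRun n) (hl hn l hwl) hc
    by_cases hin : ∃ (h : n < T) (l : Leaf m), w ⟨n, h⟩ = some l ∧ a.1 <:+ l.1
    · obtain ⟨hn, l, hwl, hal⟩ := hin
      have hwl' := (hw _ l hal).1 hwl
      rcases treeRun_succ (A := A) (pick := pick) (data := data) (w := w) n with
        ⟨h1, h⟩ | ⟨_, l1, hl1, h⟩
      · rw [h1 hn] at hwl
        exact absurd hwl (by simp)
      rcases treeRun_succ (A := A) (pick := pick) (data := data) (w := w') n with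
        ⟨h1, h'⟩ | ⟨_, l1', hl1', h'⟩
      · rw [h1 hn] at hwl'
        exact absurd hwl' (by simp)
      obtain rfl : l1 = l := by rw [hl1] at hwl; simpa using hwl
      obtain rfl : l1' = l1 := by rw [hl1'] at hwl'; simpa using hwl'
      rw [h] at hc ⊢
      rw [h'] at hc' ⊢
      exact AgreeOn.treeRound ha (frontier_treeRun n) (frontier_treeRun n) ih hal hg hc hc'
    · push Not at hin
      refine ((out hin hc).symm.trans ih).trans (out ?_ hc')
      intro h l hl hal
      exact hin h l ((hw _ l hal).2 hl) hal

/-- A run has read only guesses at inner vertices covered by now; all others may be fixed later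
without altering the past. -/
theorem treeRun_congr_guess {n : ℕ}
    (h : ∀ u : Vertex m, u.1.length < m →
      Covered (treeRun A pick data g ρ v₀ w n).pertinent u → g u = g' u) :
    treeRun A pick data g ρ v₀ w n = treeRun A pick data g' ρ v₀ w n := by
  induction n with
  | zero => rfl
  | succ n ih =>
    have ih := ih fun u hu hc => h u hu (covered_treeRun_succ hc)
    rcases treeRun_succ (A := A) (pick := pick) (data := data) (w := w) n with
      ⟨_, h1⟩ | ⟨_, l, _, h1⟩
    · rw [h1, h1, ih]
    · rw [h1] at h
      rw [h1, h1, ← ih]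
      exact treeRound_congr_guess (frontier_treeRun n) h

/-- The pertinent vertices and the samples do not depend on the random choices. -/
theorem treeRun_core (n : ℕ) :
    (treeRun A pick data g ρ' v₀' w n).pertinent = (treeRun A pick data g ρ v₀ w n).pertinent ∧
    (treeRun A pick data g ρ' v₀' w n).sample = (treeRun A pick data g ρ v₀ w n).sample := by
  induction n with
  | zero => exact ⟨rfl, rfl⟩
  | succ n ih =>
    rcases treeRun_succ (A := A) (pick := pick) (data := data) (w := w) n with
      ⟨_, h1⟩ | ⟨_, l, _, h1⟩ <;> rw [h1, h1]
    · exact ih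
    · exact treeRound_core _ _ (frontier_treeRun n) ih

/-- A pair of siblings with the predictor `f` that is eligible for output: a merge has taken place,
or `a` is the initial output vertex. -/
structure Eligible (A : Learner X) (v₀ : Leaf m) (st : TreeState X m) (a : Vertex m)
    (f : X → Bool) : Prop where
  ne_root : a ≠ root m
  mem : a ∈ st.pertinent
  sib_mem : sib a ∈ st.pertinent
  predictor_eq : predictor A st a = some f
  predictor_sib : predictor A st (sib a) = some f
  merged : st.pertinent ≠ (initTree (X := X) v₀).pertinent ∨ a = v₀.toVertex

theorem Eligible.of_core {st st' : TreeState X m} {a : Vertex m} {f : X → Bool}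
    (h : Eligible A v₀ st a f) (hst : st'.pertinent = st.pertinent ∧ st'.sample = st.sample) :
    Eligible A v₀ st' a f := by
  obtain ⟨h1, h2, h3, h4, h5, h6⟩ := h
  unfold predictor at h4 h5
  rw [← hst.2] at h4 h5
  rw [← hst.1] at h2 h3 h6
  exact ⟨h1, h2, h3, h4, h5, h6⟩

/-- The output vertex is the initial one, or it was selected in the last round with a merge from
the set of all candidates. -/
theorem treeRun_out (ρ₀ : Fin T → Chooser m) (n : ℕ) :
    ((treeRun A pick data g ρ₀ v₀ w n).pertinent = (initTree (X := X) v₀).pertinent ∧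
      ∀ ρ, (treeRun A pick data g ρ v₀ w n).out = v₀.toVertex) ∨
    (treeRun A pick data g ρ₀ v₀ w n).pertinent = {root m} ∨
    ∃ τ : Fin T, (w τ).isSome ∧ ∃ (C : Finset (Vertex m)) (hC : C.Nonempty),
      (∀ v, v ≠ root m → v ∈ (treeRun A pick data g ρ₀ v₀ w n).pertinent →
        sib v ∈ (treeRun A pick data g ρ₀ v₀ w n).pertinent → v ∈ C) ∧
      ∀ ρ, (treeRun A pick data g ρ v₀ w n).out = (ρ τ ⟨C, hC⟩).1 := by
  induction n with
  | zero => exact Or.inl ⟨rfl, fun _ => rfl⟩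
  | succ n ih =>
    have core : ∀ ρ, _ := fun ρ => treeRun_core (A := A) (pick := pick) (data := data) (g := g)
      (ρ := ρ₀) (ρ' := ρ) (v₀ := v₀) (v₀' := v₀) (w := w) n
    have core' : ∀ ρ, _ := fun ρ => treeRun_core (A := A) (pick := pick) (data := data) (g := g)
      (ρ := ρ₀) (ρ' := ρ) (v₀ := v₀) (v₀' := v₀) (w := w) (n + 1)
    -- A round without a merge changes neither the pertinent set nor the output vertex, so the
    -- alternative of the previous round persists.
    have keep : (∀ ρ, (treeRun A pick data g ρ v₀ w (n + 1)).out =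
          (treeRun A pick data g ρ v₀ w n).out) →
        (treeRun A pick data g ρ₀ v₀ w (n + 1)).pertinent =
          (treeRun A pick data g ρ₀ v₀ w n).pertinent →
        _ := fun h1 h2 => by
      rw [← h2] at ih
      simp_rw [← h1] at ih
      exact ih
    rcases treeRun_succ (A := A) (pick := pick) (data := data) (w := w) n with
      ⟨_, h1⟩ | ⟨hn, l, hwl, h1⟩
    · exact keep (fun ρ => by rw [h1]) (by rw [h1])
    · rcases treeRound_cases (A := A) (pick := pick ⟨n, hn⟩) (guess := g) (ρ := ρ₀ ⟨n, hn⟩)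
        (l := l) (z := data ⟨n, hn⟩) (frontier_treeRun (A := A) (pick := pick) (data := data)
          (g := g) (ρ := ρ₀) (v₀ := v₀) (w := w) n) with ⟨hr, h2⟩ | ⟨v, hv, hvl, hvr, h2⟩
      · right; left
        rw [h1, h2]
        have hF := frontier_treeRun (A := A) (pick := pick) (data := data)
          (g := g) (ρ := ρ₀) (v₀ := v₀) (w := w) n
        ext u
        rw [Finset.mem_singleton]
        exact ⟨fun hu => (hF.antichain _ hr u hu List.nil_suffix).symm, fun hu => hu ▸ hr⟩
      · have h3 := fun ρ : Fin T → Chooser m => treeRound_of_mem (A := A) (pick := pick ⟨n, hn⟩)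
          (g := g) (ρ := ρ ⟨n, hn⟩) (l := l) (z := data ⟨n, hn⟩) (frontier_treeRun (A := A)
            (pick := pick) (data := data) (g := g) (ρ := ρ) (v₀ := v₀) (w := w) n)
            ((core ρ).1 ▸ hv) hvl hvr
        have clash_iff : ∀ ρ, Clash A (addExample (treeRun A pick data g ρ v₀ w n) v
            (data ⟨n, hn⟩)) v ↔ Clash A (addExample (treeRun A pick data g ρ₀ v₀ w n) v
            (data ⟨n, hn⟩)) v := by
          intro ρ
          unfold Clash predictor addExample
          rw [(core ρ).1, (core ρ).2]
        by_cases hc : Clash A (addExample (treeRun A pick data g ρ₀ v₀ w n) v (data ⟨n, hn⟩)) v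
        · have h4 : ∀ ρ, treeRun A pick data g ρ v₀ w (n + 1) = reselect A (ρ ⟨n, hn⟩)
              (whileLoop A (pick ⟨n, hn⟩) g v.1 v.2
                (addExample (treeRun A pick data g ρ v₀ w n) v (data ⟨n, hn⟩))) := by
            intro ρ
            rw [h1]
            rcases h3 ρ with ⟨h4, _⟩ | ⟨_, h4⟩
            · exact absurd ((clash_iff ρ).2 hc) h4
            · exact h4
          -- Runs with different random choices differ only in the output vertex, so the candidate
          -- set below is the same for all `ρ`.
          have h5 : ∀ ρ, ∃ o, addExample (treeRun A pick data g ρ v₀ w n) v (data ⟨n, hn⟩) =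
              { addExample (treeRun A pick data g ρ₀ v₀ w n) v (data ⟨n, hn⟩) with out := o } := by
            intro ρ
            refine ⟨(treeRun A pick data g ρ v₀ w n).out, ?_⟩
            unfold addExample
            rw [(core ρ).1, (core ρ).2]
          set s := whileLoop A (pick ⟨n, hn⟩) g v.1 v.2
                (addExample (treeRun A pick data g ρ₀ v₀ w n) v (data ⟨n, hn⟩)) with hs
          have h6 : ∀ ρ, ∃ o, treeRun A pick data g ρ v₀ w (n + 1) = reselect A (ρ ⟨n, hn⟩)
              { s with out := o } := by
            intro ρ
            obtain ⟨o, ho⟩ := h5 ρ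
            refine ⟨o, ?_⟩
            rw [h4, ho, whileLoop_out]
          rcases reselect_cases A (ρ₀ ⟨n, hn⟩) s with ⟨hC, h7⟩ | ⟨hC, h7⟩
          · right; right
            refine ⟨⟨n, hn⟩, by rw [hwl]; rfl, collisions A s, hC, ?_, ?_⟩
            · intro u hu1 hu2 hu3
              rw [h4, h7] at hu2 hu3
              refine (mem_collisions ?_).2 ⟨hu1, hu2, hu3⟩
              exact not_clash_whileLoop v fun u hu => clash_addExample (not_clash_treeRun n) hu
            · intro ρ
              obtain ⟨o, ho⟩ := h6 ρ
              rw [ho]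
              rcases reselect_cases A (ρ ⟨n, hn⟩) { s with out := o } with ⟨hC', h8⟩ | ⟨hC', h8⟩
              · rw [h8]; rfl
              · rw [collisions_out] at hC'
                exact absurd hC' hC.ne_empty
          · right; left
            rw [h4, h7]
        · have h4 : ∀ ρ, treeRun A pick data g ρ v₀ w (n + 1) =
                addExample (treeRun A pick data g ρ v₀ w n) v (data ⟨n, hn⟩) := by
            intro ρ
            rw [h1]
            rcases h3 ρ with ⟨_, h4⟩ | ⟨h4, _⟩
            · exact h4
            · exact absurd ((clash_iff ρ).1 h4) hc
          exact keep (fun ρ => by rw [h4]; rfl) (by rw [h4]; rfl)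

/-- The field `merged` handles the initial output, which is not random: before any merge,
eligibility forces `a` to be that leaf. After a merge, `a` was among the candidates of the latest
selection. Both alternatives hold uniformly in `ρ`. -/
theorem Eligible.out {ρ₀ : Fin T → Chooser m} {n : ℕ} {a : Vertex m} {f : X → Bool}
    (h : Eligible A v₀ (treeRun A pick data g ρ₀ v₀ w n) a f) :
    (∀ ρ, (treeRun A pick data g ρ v₀ w n).out = a) ∨
    ∃ τ : Fin T, (w τ).isSome ∧ ∃ (C : Finset (Vertex m)) (hC : C.Nonempty), a ∈ C ∧
      ∀ ρ, (treeRun A pick data g ρ v₀ w n).out = (ρ τ ⟨C, hC⟩).1 := by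
  rcases treeRun_out (A := A) (pick := pick) (data := data) (g := g) (v₀ := v₀) (w := w) ρ₀ n with
    ⟨h1, h2⟩ | h1 | ⟨τ, hτ, C, hC, h1, h2⟩
  · left
    rw [h.merged.resolve_left (fun h' => h' h1)]
    exact h2
  · have := h.mem
    rw [h1, Finset.mem_singleton] at this
    exact absurd this h.ne_root
  · exact Or.inr ⟨τ, hτ, C, hC, h1 a h.ne_root h.mem h.sib_mem, h2⟩

end Run

/-! ### Correct guesses -/

section Guess

variable {X : Type*} {T m d : ℕ} {A : Learner X} {H : Set (X → Bool)} {hs : X → Bool}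

/-- The pertinent samples are consistent with `hs`, and the learner makes at least one mistake per
level on them. -/
def Progress (A : Learner X) (hs : X → Bool) (st : TreeState X m) : Prop :=
  ∀ v ∈ st.pertinent, ∃ S, st.sample v = some S ∧ (∀ z ∈ S, hs z.1 = z.2) ∧
    m ≤ mistakes A S + v.1.length

theorem progress_initTree (v₀ : Leaf m) : Progress A hs (initTree (X := X) v₀) := by
  intro v hv
  simp only [initTree, Finset.mem_filter, Finset.mem_univ, true_and] at hv
  exact ⟨[], by simp [initTree, hv], by simp, by omega⟩

theorem Progress.addExample {st : TreeState X m} (h : Progress A hs st) (v : Vertex m)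
    {z : X × Bool} (hz : hs z.1 = z.2) : Progress A hs (DPSOA.addExample st v z) := by
  intro u hu
  obtain ⟨S, h1, h2, h3⟩ := h u hu
  by_cases huv : u = v
  · subst huv
    refine ⟨S ++ [z], by simp [DPSOA.addExample, h1], ?_, ?_⟩
    · intro z' hz'
      rcases List.mem_append.1 hz' with h4 | h4
      · exact h2 z' h4
      · rw [List.mem_singleton.1 h4]; exact hz
    · rw [mistakes_append_singleton]; omega
  · exact ⟨S, by simp [DPSOA.addExample, huv, h1], h2, h3⟩

/-- With the label of `hs`, a merge preserves progress. -/
theorem Progress.exists_merge {pick : Sample X → Sample X → X}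
    (hpick : ∀ S₁ S₂ : Sample X, A S₁ ≠ A S₂ → A S₁ (pick S₁ S₂) ≠ A S₂ (pick S₁ S₂))
    {st : TreeState X m} (h : Progress A hs st) {v : Vertex m} (hc : Clash A st v) :
    ∃ y, ∀ g : Vertex m → Bool, g (parent v) = y → Progress A hs (merge A pick g st v) := by
  obtain ⟨S₁, h1, h2, h3⟩ := h v hc.2.1
  obtain ⟨S₂, h1', h2', h3'⟩ := h (sib v) hc.2.2
  refine ⟨hs (pick S₁ S₂), fun g hg u hu => ?_⟩
  rw [mem_merge_pertinent] at hu
  by_cases hup : u = parent v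
  · subst hup
    have hne : A S₁ ≠ A S₂ := by
      intro h4
      apply hc.1
      simp [predictor, h1, h1', h4]
    have hpk := hpick S₁ S₂ hne
    have hlen : (parent v).1.length + 1 = v.1.length ∧ (sib v).1.length = v.1.length := by
      obtain ⟨b, p, hbp, rfl⟩ := vertex_ne_root_iff.1 hc.ne_root
      simp [parent, sib]
    refine ⟨(if A S₁ (pick S₁ S₂) ≠ hs (pick S₁ S₂) then S₁ else S₂) ++
      [(pick S₁ S₂, hs (pick S₁ S₂))], by simp [merge, h1, h1', hg], ?_, ?_⟩
    · intro z hz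
      rcases List.mem_append.1 hz with h4 | h4
      · split_ifs at h4
        · exact h2 z h4
        · exact h2' z h4
      · rw [List.mem_singleton.1 h4]
    · rw [mistakes_append_singleton]
      -- The predictors differ at the picked point, so one errs there against `hs`. The sample kept
      -- is one that errs, and the extra mistake pays for the level climbed.
      by_cases h4 : A S₁ (pick S₁ S₂) ≠ hs (pick S₁ S₂)
      · rw [if_pos h4, if_pos h4]; omega
      · have h5 : A S₂ (pick S₁ S₂) ≠ hs (pick S₁ S₂) := by
          push Not at h4
          rw [← h4]; exact hpk.symm
        rw [if_neg h4, if_pos h5]; omega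
  · obtain ⟨S, h4, h5, h6⟩ := h u (hu.resolve_left hup).2.2
    exact ⟨S, by simp [merge, hup, h4], h5, h6⟩

theorem Progress.exists_whileLoop {pick : Sample X → Sample X → X}
    (hpick : ∀ S₁ S₂ : Sample X, A S₁ ≠ A S₂ → A S₁ (pick S₁ S₂) ≠ A S₂ (pick S₁ S₂))
    (l : List Bool) (hl : l.length ≤ m) {st : TreeState X m} (h : Progress A hs st)
    (g : Vertex m → Bool) :
    ∃ g' : Vertex m → Bool, (∀ u : Vertex m, ¬ (u.1 <:+ l ∧ u.1 ≠ l) → g' u = g u) ∧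
      Progress A hs (whileLoop A pick g' l hl st) := by
  induction l generalizing st g with
  | nil => exact ⟨g, fun _ _ => rfl, h⟩
  | cons b p ih =>
    by_cases hc : Clash A st ⟨b :: p, hl⟩
    · obtain ⟨y, hy⟩ := h.exists_merge hpick hc
      have hp : p.length ≤ m := (Nat.le_succ p.length).trans hl
      let g₁ := Function.update g ⟨p, hp⟩ y
      have hg₁ : g₁ ⟨p, hp⟩ = y := by simp [g₁]
      obtain ⟨g₂, h1, h2⟩ := ih hp (hy g₁ hg₁) g₁
      refine ⟨g₂, ?_, ?_⟩
      · intro u hu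
        rw [h1]
        · refine Function.update_of_ne ?_ _ _
          rintro rfl
          exact hu ⟨List.suffix_cons _ _, by simp⟩
        · rintro ⟨h3, -⟩
          refine hu ⟨h3.trans (List.suffix_cons _ _), ?_⟩
          intro h4
          rw [h4] at h3
          exact not_cons_suffix_self _ _ h3
      · rw [whileLoop, if_pos hc, merge_congr_guess (g := g₂) (g' := g₁) (h1 _ (by simp [parent]))]
        exact h2
    · exact ⟨g, fun _ _ => rfl, by rw [whileLoop, if_neg hc]; exact h⟩

/-- At depth `0` progress means a realizable sample with at least `m > d` mistakes, against the
mistake bound. -/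
theorem Progress.root_notMem (hA : HasMistakeBound A H d) (hsH : hs ∈ H) (hdm : d < m)
    {st : TreeState X m} (h : Progress A hs st) : root m ∉ st.pertinent := by
  intro hr
  obtain ⟨S, -, h2, h3⟩ := h _ hr
  have := hA S ⟨hs, hsH, h2⟩
  simp only [root, List.length_nil] at h3
  omega

/-- The labels to be corrected sit strictly above the antecedent of the leaf, where nothing was
covered before the round. This compatibility with the past lets `exists_progress` build a correct
labelling although the right label of a vertex depends on the run. -/
theorem Progress.exists_treeRound (hA : HasMistakeBound A H d) (hsH : hs ∈ H) (hdm : d < m)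
    {pick : Sample X → Sample X → X}
    (hpick : ∀ S₁ S₂ : Sample X, A S₁ ≠ A S₂ → A S₁ (pick S₁ S₂) ≠ A S₂ (pick S₁ S₂))
    {st : TreeState X m} (hP : Frontier st.pertinent) (hst : ∀ u, ¬ Clash A st u)
    (h : Progress A hs st) (g : Vertex m → Bool) (ρ : Chooser m) (l : Leaf m) {z : X × Bool}
    (hz : hs z.1 = z.2) :
    ∃ g' : Vertex m → Bool, (∀ u, Covered st.pertinent u → g u = g' u) ∧
      Progress A hs (treeRound A pick g' ρ l z st) := by
  obtain ⟨v, hvP, hvl⟩ := hP.cover l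
  have hvr : v ≠ root m := fun h' => h.root_notMem hA hsH hdm (h' ▸ hvP)
  obtain ⟨g', h1, h2⟩ := (h.addExample v hz).exists_whileLoop hpick v.1 v.2 g
  refine ⟨g', ?_, ?_⟩
  · intro u hu
    rw [h1]
    rintro ⟨h3, h4⟩
    exact hP.not_covered hvP h3 (fun h5 => h4 (by rw [h5])) hu
  · rcases treeRound_of_mem (A := A) (pick := pick) (g := g') (ρ := ρ) (z := z) hP hvP hvl hvr with
      ⟨_, h3⟩ | ⟨_, h3⟩ <;> rw [h3]
    · exact h.addExample v hz
    · rcases reselect_cases A ρ (whileLoop A pick g' v.1 v.2 (DPSOA.addExample st v z)) with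
        ⟨_, h4⟩ | ⟨hC, h4⟩ <;> rw [h4]
      · exact h2
      -- The branch without candidates cannot occur: the root is not pertinent, so the frontier
      -- contains two siblings, and they no longer clash.
      · obtain ⟨u, hu1, hu2, hu3⟩ := (frontier_whileLoop A pick g' v.1 v.2 _
          (show Frontier (DPSOA.addExample st v z).pertinent from hP)).exists_siblings
          (h2.root_notMem hA hsH hdm)
        have := (mem_collisions (A := A) (not_clash_whileLoop (pick := pick) (g := g') v
          fun u hu => clash_addExample hst hu)).2 ⟨hu2, hu1, hu3⟩
        rw [hC] at this
        simp at this

variable {pick : Fin T → Sample X → Sample X → X} {data : Fin T → X × Bool}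
  {ρ : Fin T → Chooser m} {v₀ : Leaf m} {w : Fin T → Option (Leaf m)}

theorem exists_progress (hA : HasMistakeBound A H d) (hsH : hs ∈ H) (hdm : d < m)
    (hpick : ∀ (t : Fin T) (S₁ S₂ : Sample X), A S₁ ≠ A S₂ →
      A S₁ (pick t S₁ S₂) ≠ A S₂ (pick t S₁ S₂))
    (hdata : ∀ t, hs (data t).1 = (data t).2) (n : ℕ) :
    ∃ g, Progress A hs (treeRun A pick data g ρ v₀ w n) := by
  induction n with
  | zero => exact ⟨fun _ => false, progress_initTree v₀⟩
  | succ n ih =>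
    obtain ⟨g, hg⟩ := ih
    rcases treeRun_succ (A := A) (pick := pick) (data := data) (w := w) n with
      ⟨_, h1⟩ | ⟨hn, l, _, h1⟩
    · exact ⟨g, by rw [h1]; exact hg⟩
    · obtain ⟨g', h2, h3⟩ := hg.exists_treeRound hA hsH hdm (hpick ⟨n, hn⟩) (frontier_treeRun n)
        (not_clash_treeRun n) g (ρ ⟨n, hn⟩) l (hdata ⟨n, hn⟩)
      refine ⟨g', ?_⟩
      rw [h1, ← treeRun_congr_guess (g := g) (g' := g') fun u _ hu => h2 u hu]
      exact h3

/-- If the guesses at the inner vertices are correct, then there is an eligible pair. -/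
theorem exists_guess_eligible (hA : HasMistakeBound A H d) (hsH : hs ∈ H) (hdm : d < m)
    (hpick : ∀ (t : Fin T) (S₁ S₂ : Sample X), A S₁ ≠ A S₂ →
      A S₁ (pick t S₁ S₂) ≠ A S₂ (pick t S₁ S₂))
    (hdata : ∀ t, hs (data t).1 = (data t).2) (n : ℕ) :
    ∃ g : Vertex m → Bool, ∀ g' : Vertex m → Bool, (∀ u : Vertex m, u.1.length < m → g u = g' u) →
      ∃ a f, Eligible A v₀ (treeRun A pick data g' ρ v₀ w n) a f := by
  obtain ⟨g, hg⟩ := exists_progress (ρ := ρ) (v₀ := v₀) (w := w) hA hsH hdm hpick hdata n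
  refine ⟨g, fun g' hgg' => ?_⟩
  rw [← treeRun_congr_guess (g := g) (g' := g') fun u hu _ => hgg' u hu]
  obtain ⟨a, ha1, ha2, ha3, ha4⟩ : ∃ a ∈ (treeRun A pick data g ρ v₀ w n).pertinent,
      a ≠ root m ∧ sib a ∈ (treeRun A pick data g ρ v₀ w n).pertinent ∧
      ((treeRun A pick data g ρ v₀ w n).pertinent ≠ (initTree (X := X) v₀).pertinent ∨
        a = v₀.toVertex) := by
    -- As long as the pertinent set is the initial one the output is the leaf `v₀`, so that leaf
    -- must be the eligible vertex; otherwise any pair of siblings will do.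
    by_cases h : (treeRun A pick data g ρ v₀ w n).pertinent = (initTree (X := X) v₀).pertinent
    · rw [h]
      have hr : v₀.toVertex ≠ root m := by
        intro h'
        have h1 : v₀.1 = [] := congrArg Subtype.val h'
        have h2 := v₀.2
        rw [h1] at h2
        simp at h2
        omega
      refine ⟨v₀.toVertex, ?_, hr, ?_, Or.inr rfl⟩
      · simp [initTree, Leaf.toVertex]
      · have hlen : v₀.toVertex.1.length = m := v₀.2
        obtain ⟨b, p, hbp, h1⟩ := vertex_ne_root_iff.1 hr
        rw [h1] at hlen ⊢
        simpa [initTree, sib] using hlen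
    · obtain ⟨a, h1, h2, h3⟩ := (frontier_treeRun (A := A) (pick := pick) (data := data)
          (g := g) (ρ := ρ) (v₀ := v₀) (w := w) n).exists_siblings (hg.root_notMem hA hsH hdm)
      exact ⟨a, h1, h2, h3, Or.inl h⟩
  obtain ⟨S, hS, -⟩ := hg a ha1
  have hp : predictor A (treeRun A pick data g ρ v₀ w n) a = some (A S) := by
    simp [predictor, hS]
  refine ⟨a, A S, ha2, ha1, ha3, hp, ?_, ha4⟩
  rw [← hp]
  by_contra hne
  exact not_clash_treeRun n a ⟨fun h => hne h.symm, ha1, ha3⟩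

end Guess

/-! ### Counting arguments -/

section Counting

/-- Double counting over a family of injective self-maps. -/
theorem card_filter_le_of_maps {Ω G : Type*} [Fintype Ω] [Fintype G] [Nonempty G]
    (Φ : G → Ω → Ω) (hΦ : ∀ s, Function.Injective (Φ s)) (Q : Ω → Prop)
    [DecidablePred Q] {δ : ℝ}
    (h : ∀ ω, ((Finset.univ.filter fun s => Q (Φ s ω)).card : ℝ) ≤ δ * Fintype.card G) :
    ((Finset.univ.filter Q).card : ℝ) ≤ δ * Fintype.card Ω := by
  have hG : (0 : ℝ) < Fintype.card G := by exact_mod_cast Fintype.card_pos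
  have h1 : ∀ s, (Finset.univ.filter fun ω => Q (Φ s ω)).card = (Finset.univ.filter Q).card := by
    intro s
    refine Finset.card_bij (fun ω _ => Φ s ω) ?_ ?_ ?_
    · intro ω hω; simpa using hω
    · intro ω _ ω' _ h; exact hΦ s h
    · intro ω hω
      obtain ⟨ω', rfl⟩ := (Finite.injective_iff_surjective.1 (hΦ s)) ω
      exact ⟨ω', by simpa using hω, rfl⟩
  have h2 : (∑ s : G, ((Finset.univ.filter fun ω => Q (Φ s ω)).card : ℝ)) =
      ∑ ω : Ω, ((Finset.univ.filter fun s => Q (Φ s ω)).card : ℝ) := by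
    simp only [Finset.card_filter, Nat.cast_sum]
    exact Finset.sum_comm
  have h3 := Finset.sum_le_sum fun ω (_ : ω ∈ Finset.univ) => h ω
  rw [← h2] at h3
  simp only [h1, Finset.sum_const, nsmul_eq_mul, Finset.card_univ] at h3
  nlinarith

/-- A bound for all fibres of a product bounds the whole. -/
theorem card_filter_le_of_fibers {Ω α β : Type*} [Fintype Ω] [Fintype α] [Fintype β]
    (e : Ω ≃ α × β) (Q : Ω → Prop)
    [DecidablePred Q] {δ : ℝ}
    (h : ∀ a, ((Finset.univ.filter fun b => Q (e.symm (a, b))).card : ℝ) ≤ δ * Fintype.card β) :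
    ((Finset.univ.filter Q).card : ℝ) ≤ δ * Fintype.card Ω := by
  have h1 : ((Finset.univ.filter Q).card : ℝ) =
      ∑ a, ((Finset.univ.filter fun b => Q (e.symm (a, b))).card : ℝ) := by
    simp only [Finset.card_filter, Nat.cast_sum]
    rw [← Fintype.sum_prod_type', ← e.sum_comp]
    simp
  rw [h1, Fintype.card_congr e, Fintype.card_prod]
  refine (Finset.sum_le_sum fun a _ => h a).trans ?_
  simp only [Finset.sum_const, nsmul_eq_mul, Finset.card_univ, Nat.cast_mul]
  apply le_of_eq
  ring

open Classical in
/-- Markov's inequality for exponentials, by counting. -/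
theorem card_filter_le_of_sum_exp {Ω : Type*} [Fintype Ω] (F : Ω → ℝ) {b c : ℝ}
    (h : ∑ ω, Real.exp (F ω) ≤ Fintype.card Ω * Real.exp b) :
    ((Finset.univ.filter fun ω => c ≤ F ω).card : ℝ) ≤ Real.exp (b - c) * Fintype.card Ω := by
  have h1 : ((Finset.univ.filter fun ω => c ≤ F ω).card : ℝ) * Real.exp c ≤
      ∑ ω, Real.exp (F ω) := by
    calc ((Finset.univ.filter fun ω => c ≤ F ω).card : ℝ) * Real.exp c
        = ∑ ω ∈ Finset.univ.filter (fun ω => c ≤ F ω), Real.exp c := by simp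
      _ ≤ ∑ ω ∈ Finset.univ.filter (fun ω => c ≤ F ω), Real.exp (F ω) :=
          Finset.sum_le_sum fun ω hω => Real.exp_le_exp.2 (Finset.mem_filter.1 hω).2
      _ ≤ ∑ ω, Real.exp (F ω) :=
          Finset.sum_le_sum_of_subset_of_nonneg (Finset.filter_subset _ _)
            fun _ _ _ => (Real.exp_pos _).le
  rw [Real.exp_sub, div_mul_eq_mul_div, le_div_iff₀ (Real.exp_pos c)]
  linarith

end Counting

/-! ### Concentration for independent events -/

section Product

open Classical in
-- The average of the exponential is `1 - (1 - 1 / e)` times the probability of `D`, and `1 - 1 / e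
-- > 3 / 5`.
theorem sum_exp_neg_indicator_le {C : Type*} [Fintype C] (D : C → Prop) {q : ℝ}
    (hD : q * Fintype.card C ≤ (Finset.univ.filter D).card) :
    ∑ x, Real.exp (-(if D x then 1 else 0)) ≤ Fintype.card C * Real.exp (-(3 / 5 * q)) := by
  have h1 : ∀ x, Real.exp (-(if D x then 1 else 0)) =
      1 - (1 - Real.exp (-1)) * (if D x then 1 else 0) := by
    intro x; split_ifs <;> simp
  simp_rw [h1]
  rw [Finset.sum_sub_distrib, ← Finset.mul_sum]
  have h2 : ∑ x, (if D x then (1 : ℝ) else 0) = (Finset.univ.filter D).card := by simp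
  rw [h2]
  have h3 := Real.exp_neg_one_lt_d9
  have h4 : (3 : ℝ) / 5 ≤ 1 - Real.exp (-1) := by linarith
  have h5 := Real.add_one_le_exp (-(3 / 5 * q))
  have h6 : (3 / 5 : ℝ) * (Finset.univ.filter D).card ≤
      (1 - Real.exp (-1)) * (Finset.univ.filter D).card := by gcongr
  have h7 : (0 : ℝ) ≤ Fintype.card C := by positivity
  simp only [Finset.sum_const, nsmul_eq_mul, Finset.card_univ, mul_one]
  nlinarith

open Classical in
/-- Among independent events of probability at least `q`, at least half of the expected number
occur, up to an exponentially small probability. -/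
theorem card_filter_pi_le {ι C : Type*} [Fintype ι] [DecidableEq ι] [Fintype C] (D : ι → C → Prop) (B : Finset ι)
    {q : ℝ} (hD : ∀ t ∈ B, q * Fintype.card C ≤ (Finset.univ.filter (D t)).card) :
    ((Finset.univ.filter fun c : ι → C =>
      ((B.filter fun t => D t (c t)).card : ℝ) ≤ q * B.card / 2).card : ℝ) ≤
      Real.exp (-(q * B.card / 10)) * Fintype.card (ι → C) := by
  have key : ∑ c : ι → C, Real.exp (-((B.filter fun t => D t (c t)).card : ℝ)) ≤
      Fintype.card (ι → C) * Real.exp (-(3 / 5 * q) * B.card) := by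
    have h1 : ∀ c : ι → C, Real.exp (-((B.filter fun t => D t (c t)).card : ℝ)) =
        ∏ t, if t ∈ B then Real.exp (-(if D t (c t) then 1 else 0)) else 1 := by
      intro c
      rw [Finset.prod_ite_mem, Finset.univ_inter, ← Real.exp_sum, Finset.sum_neg_distrib]
      simp
    simp_rw [h1]
    rw [← Fintype.piFinset_univ, ← Finset.prod_univ_sum (fun _ => Finset.univ)
      (fun t x => if t ∈ B then Real.exp (-(if D t x then 1 else 0)) else 1)]
    calc ∏ t, ∑ x, (if t ∈ B then Real.exp (-(if D t x then 1 else 0)) else 1)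
        ≤ ∏ t : ι, ((Fintype.card C : ℝ) * if t ∈ B then Real.exp (-(3 / 5 * q)) else 1) := by
          refine Finset.prod_le_prod (fun t _ => Finset.sum_nonneg fun x _ => ?_) fun t _ => ?_
          · split_ifs <;> positivity
          · split_ifs with ht
            · exact sum_exp_neg_indicator_le _ (hD t ht)
            · simp
      _ = Fintype.card (ι → C) * Real.exp (-(3 / 5 * q) * B.card) := by
          rw [Finset.prod_mul_distrib, Finset.prod_ite_mem, Finset.univ_inter]
          simp only [Finset.prod_const, Finset.card_univ, Fintype.card_fun, Nat.cast_pow]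
          rw [← Real.exp_nat_mul, mul_comm (B.card : ℝ)]
  -- The exponent is `-(3 / 5) + 1 / 2 = -(1 / 10)` times `q * B.card`.
  have := card_filter_le_of_sum_exp (fun c : ι → C => -((B.filter fun t => D t (c t)).card : ℝ))
    (c := -(q * B.card / 2)) key
  simp only [neg_le_neg_iff] at this
  convert this using 3
  ring

end Product

/-! ### Concentration for random permutations -/

section Permutations

/-- Convexity: on `[-2, 2]` the exponential lies below its chord. Summing over values with sum zero
kills the linear term, which gives Hoeffding's lemma. -/
theorem exp_mul_le_cosh_add {y : ℝ} (hy : |y| ≤ 2) (s : ℝ) :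
    Real.exp (s * y) ≤ Real.cosh (2 * s) + y / 2 * Real.sinh (2 * s) := by
  obtain ⟨h1, h2⟩ := abs_le.1 hy
  have := convexOn_exp.2 (Set.mem_univ (-(2 * s))) (Set.mem_univ (2 * s))
    (show 0 ≤ (2 - y) / 4 by linarith) (show 0 ≤ (2 + y) / 4 by linarith) (by ring)
  simp only [smul_eq_mul] at this
  rw [Real.cosh_eq, Real.sinh_eq]
  calc Real.exp (s * y) = Real.exp ((2 - y) / 4 * -(2 * s) + (2 + y) / 4 * (2 * s)) := by
        congr 1; ring
    _ ≤ _ := this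
    _ = _ := by ring

theorem sum_exp_le_of_sum_eq_zero {ι : Type*} [Fintype ι] (y : ι → ℝ) (hy : ∀ i, |y i| ≤ 2)
    (h0 : ∑ i, y i = 0) (s : ℝ) :
    ∑ i, Real.exp (s * y i) ≤ Fintype.card ι * Real.exp (2 * s ^ 2) := by
  calc ∑ i, Real.exp (s * y i) ≤ ∑ i, (Real.cosh (2 * s) + y i / 2 * Real.sinh (2 * s)) :=
        Finset.sum_le_sum fun i _ => exp_mul_le_cosh_add (hy i) s
    _ = Fintype.card ι * Real.cosh (2 * s) := by
        rw [Finset.sum_add_distrib, ← Finset.sum_mul, ← Finset.sum_div, h0]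
        simp
    _ ≤ _ := by
        gcongr
        refine (Real.cosh_le_exp_half_sq _).trans (le_of_eq ?_)
        congr 1; ring

theorem sum_succ_swap {n : ℕ} (p : Fin (n + 1)) (f : Fin (n + 1) → ℝ) :
    ∑ k : Fin n, f (Equiv.swap 0 p k.succ) = ∑ c, f c - f p := by
  rw [← Equiv.sum_comp (Equiv.swap 0 p) f, Fin.sum_univ_succ]
  simp

/-- The moment generating function of `∑ i, M i (π i)` for a uniformly random permutation `π`. -/
theorem sum_perm_exp_le (n : ℕ) (M : Fin n → Fin n → ℝ) (hM : ∀ i j, 0 ≤ M i j ∧ M i j ≤ 1)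
    (s : ℝ) :
    ∑ π : Equiv.Perm (Fin n), Real.exp (s * (∑ i, M i (π i) - (∑ i, ∑ j, M i j) / n)) ≤
      Fintype.card (Equiv.Perm (Fin n)) * Real.exp (2 * s ^ 2 * n) := by
  induction n with
  | zero => simp
  | succ n ih =>
    set R := ∑ i : Fin n, ∑ c, M i.succ c with hR
    set K : Fin (n + 1) → ℝ := fun p => ∑ i : Fin n, M i.succ p with hK
    set μ := (∑ i, ∑ j, M i j) / ((n + 1 : ℕ) : ℝ) with hμ
    have hn1 : (0 : ℝ) < ((n + 1 : ℕ) : ℝ) := by positivity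
    have hKR : ∑ p, K p = R := by rw [hR, hK]; exact Finset.sum_comm
    have hμ' : ((n + 1 : ℕ) : ℝ) * μ = ∑ p, M 0 p + R := by
      rw [hμ, mul_div_cancel₀ _ hn1.ne', Fin.sum_univ_succ]
    have hK0 : ∀ p, 0 ≤ K p ∧ K p ≤ n := by
      intro p
      refine ⟨Finset.sum_nonneg fun i _ => (hM _ _).1, ?_⟩
      refine (Finset.sum_le_sum fun i _ => (hM _ _).2).trans ?_
      simp
    -- The change of the conditional mean when the value `π 0 = p` is revealed: a bounded martingale
    -- increment.
    set y : Fin (n + 1) → ℝ := fun p => M 0 p + (R - K p) / n - μ with hy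
    have hy0 : ∑ p, y p = 0 := by
      have h1 : ∑ p, (R - K p) / (n : ℝ) = R := by
        rw [← Finset.sum_div, Finset.sum_sub_distrib, hKR]
        simp only [Finset.sum_const, Finset.card_univ, Fintype.card_fin, nsmul_eq_mul]
        rcases Nat.eq_zero_or_pos n with rfl | hn
        · simp [hR]
        · have : (n : ℝ) ≠ 0 := by positivity
          push_cast
          field_simp
          ring
      simp only [hy]
      rw [Finset.sum_sub_distrib, Finset.sum_add_distrib, h1]
      simp only [Finset.sum_const, Finset.card_univ, Fintype.card_fin, nsmul_eq_mul]
      linarith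
    have hydiff : ∀ p q, y p - y q ≤ 2 := by
      intro p q
      have h1 : (R - K p) / (n : ℝ) - (R - K q) / n ≤ 1 := by
        rw [← sub_div]
        refine div_le_one_of_le₀ ?_ (by positivity)
        have := (hK0 p).1
        have := (hK0 q).2
        linarith
      have h2 := (hM 0 p).2
      have h3 := (hM 0 q).1
      simp only [hy]
      linarith
    -- The values sum to zero and differ pairwise by at most `2`; averaging over the second index
    -- bounds each one.
    have hyabs : ∀ p, |y p| ≤ 2 := by
      intro p
      have h1 : ∑ q, (y p - y q) ≤ ∑ q : Fin (n + 1), 2 :=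
        Finset.sum_le_sum fun q _ => hydiff p q
      have h2 : ∑ q, (y q - y p) ≤ ∑ q : Fin (n + 1), 2 :=
        Finset.sum_le_sum fun q _ => hydiff q p
      rw [Finset.sum_sub_distrib, hy0] at h1 h2
      simp only [Finset.sum_const, Finset.card_univ, Fintype.card_fin, nsmul_eq_mul] at h1 h2
      rw [abs_le]
      constructor <;> nlinarith
    -- Given `π 0 = p`, the rest is a uniform permutation of the smaller matrix without row `0` and
    -- column `p`, to which the induction hypothesis applies.
    have hstep : ∀ p, ∑ e : Equiv.Perm (Fin n), Real.exp (s * (∑ i,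
        M i ((Equiv.Perm.decomposeFin.symm (p, e)) i) - μ)) ≤
        Real.exp (s * y p) *
          (Fintype.card (Equiv.Perm (Fin n)) * Real.exp (2 * s ^ 2 * n)) := by
      intro p
      have h1 := ih (fun i k => M i.succ (Equiv.swap 0 p k.succ)) (fun i k => hM _ _)
      have h2 : ∑ i : Fin n, ∑ k : Fin n, M i.succ (Equiv.swap 0 p k.succ) = R - K p := by
        simp_rw [fun i : Fin n => sum_succ_swap p (M i.succ)]
        rw [Finset.sum_sub_distrib]
      rw [h2] at h1
      refine le_trans (le_of_eq ?_) (mul_le_mul_of_nonneg_left h1 (Real.exp_pos _).le)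
      rw [Finset.mul_sum]
      refine Finset.sum_congr rfl fun e _ => ?_
      rw [← Real.exp_add, Fin.sum_univ_succ]
      simp only [Equiv.Perm.decomposeFin_symm_apply_zero, Equiv.Perm.decomposeFin_symm_apply_succ,
        hy]
      congr 1
      ring
    calc ∑ π : Equiv.Perm (Fin (n + 1)), Real.exp (s * (∑ i, M i (π i) - μ))
        = ∑ p, ∑ e : Equiv.Perm (Fin n), Real.exp (s * (∑ i,
            M i ((Equiv.Perm.decomposeFin.symm (p, e)) i) - μ)) := by
          rw [← Fintype.sum_prod_type', ← Equiv.Perm.decomposeFin.symm.sum_comp]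
      _ ≤ ∑ p, Real.exp (s * y p) *
          (Fintype.card (Equiv.Perm (Fin n)) * Real.exp (2 * s ^ 2 * n)) :=
          Finset.sum_le_sum fun p _ => hstep p
      _ ≤ ((n + 1 : ℕ) * Real.exp (2 * s ^ 2)) *
          (Fintype.card (Equiv.Perm (Fin n)) * Real.exp (2 * s ^ 2 * n)) := by
          rw [← Finset.sum_mul]
          gcongr
          simpa using sum_exp_le_of_sum_eq_zero y hyabs hy0 s
      _ = _ := by
          rw [Fintype.card_perm, Fintype.card_perm, Fintype.card_fin, Fintype.card_fin,
            Nat.factorial_succ]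
          have : Real.exp (2 * s ^ 2 * ((n + 1 : ℕ) : ℝ)) =
              Real.exp (2 * s ^ 2) * Real.exp (2 * s ^ 2 * n) := by
            rw [← Real.exp_add]; congr 1; push_cast; ring
          rw [this]
          push_cast
          ring

open Classical in
theorem card_perm_deviation_le {n : ℕ} (M : Fin n → Fin n → ℝ)
    (hM : ∀ i j, 0 ≤ M i j ∧ M i j ≤ 1) {σ ε : ℝ} (hσ : σ ^ 2 = 1) (hε : 0 ≤ ε) :
    ((Finset.univ.filter fun π : Equiv.Perm (Fin n) =>
      ε * n ≤ σ * (∑ i, M i (π i) - (∑ i, ∑ j, M i j) / n)).card : ℝ) ≤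
      Real.exp (-(ε ^ 2 * n / 8)) * Fintype.card (Equiv.Perm (Fin n)) := by
  -- `s = σ * ε / 4` minimizes the Markov exponent `2 * s ^ 2 * n - |s| * ε * n`; the sign `σ`
  -- selects the tail.
  have h := card_filter_le_of_sum_exp _ (c := ε ^ 2 * n / 4) (sum_perm_exp_le n M hM (σ * ε / 4))
  have h1 : 2 * (σ * ε / 4) ^ 2 * n - ε ^ 2 * n / 4 = -(ε ^ 2 * n / 8) := by
    have : 2 * (σ * ε / 4) ^ 2 * n = σ ^ 2 * (ε ^ 2 * n / 8) := by ring
    rw [this, hσ]; ring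
  rw [h1] at h
  refine le_trans ?_ h
  refine Nat.cast_le.2 (Finset.card_le_card fun π hπ => ?_)
  simp only [Finset.mem_filter, Finset.mem_univ, true_and] at hπ ⊢
  have := mul_le_mul_of_nonneg_left hπ (show 0 ≤ ε / 4 by linarith)
  calc ε ^ 2 * n / 4 = ε / 4 * (ε * n) := by ring
    _ ≤ _ := this
    _ = _ := by ring

end Permutations

/-! ### A frequent label -/

section Matrix

open Classical in
/-- Consider a partial labelling of an `n × n` matrix in which any two labelled entries in the same
row or in the same column have the same label. If many entries are labelled, then some label is
frequent. -/
theorem exists_frequent_label {n : ℕ} {F : Type*} [Inhabited F] (M : F → Fin n → Fin n → Prop)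
    (hrow : ∀ f f' i j j', M f i j → M f' i j' → f = f')
    (hcol : ∀ f f' i i' j, M f i j → M f' i' j → f = f') {p : ℝ} (hp : 0 ≤ p)
    (h : p * n ^ 2 < (Finset.univ.filter fun ij : Fin n × Fin n => ∃ f, M f ij.1 ij.2).card) :
    ∃ f, p ^ 2 * n ^ 2 ≤ (Finset.univ.filter fun ij : Fin n × Fin n => M f ij.1 ij.2).card := by
  by_contra! hlt
  set 𝓕 : Finset F := Finset.univ.image fun ij : Fin n × Fin n =>
    if h : ∃ f, M f ij.1 ij.2 then h.choose else default with h𝓕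
  set N : F → Finset (Fin n × Fin n) := fun f => Finset.univ.filter fun ij => M f ij.1 ij.2
  set R : F → Finset (Fin n) := fun f => Finset.univ.filter fun i => ∃ j, M f i j
  set K : F → Finset (Fin n) := fun f => Finset.univ.filter fun j => ∃ i, M f i j
  have hsub : (Finset.univ.filter fun ij : Fin n × Fin n => ∃ f, M f ij.1 ij.2) ⊆ 𝓕.biUnion N := by
    intro ij hij
    simp only [Finset.mem_filter, Finset.mem_univ, true_and] at hij
    rw [Finset.mem_biUnion]
    refine ⟨hij.choose, ?_, by simpa [N] using hij.choose_spec⟩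
    rw [h𝓕, Finset.mem_image]
    exact ⟨ij, Finset.mem_univ _, dif_pos hij⟩
  have hNRK : ∀ f, ((N f).card : ℝ) ≤ (R f).card * (K f).card := by
    intro f
    have : N f ⊆ R f ×ˢ K f := by
      rintro ⟨i, j⟩ hij
      simp only [N, R, K, Finset.mem_filter, Finset.mem_univ, true_and,
        Finset.mem_product] at hij ⊢
      exact ⟨⟨j, hij⟩, ⟨i, hij⟩⟩
    have h1 := Finset.card_le_card this
    rw [Finset.card_product] at h1
    exact_mod_cast h1
  have hR : (∑ f ∈ 𝓕, ((R f).card : ℝ)) ≤ n := by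
    have h1 : ∑ f ∈ 𝓕, (R f).card = (𝓕.biUnion R).card := by
      refine (Finset.card_biUnion fun f _ f' _ hne => ?_).symm
      rw [Function.onFun, Finset.disjoint_left]
      intro i hi hi'
      simp only [R, Finset.mem_filter, Finset.mem_univ, true_and] at hi hi'
      obtain ⟨j, hj⟩ := hi
      obtain ⟨j', hj'⟩ := hi'
      exact hne (hrow _ _ _ _ _ hj hj')
    have h2 := Finset.card_le_univ (𝓕.biUnion R)
    rw [← h1, Fintype.card_fin] at h2
    exact_mod_cast h2
  have hK : (∑ f ∈ 𝓕, ((K f).card : ℝ)) ≤ n := by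
    have h1 : ∑ f ∈ 𝓕, (K f).card = (𝓕.biUnion K).card := by
      refine (Finset.card_biUnion fun f _ f' _ hne => ?_).symm
      rw [Function.onFun, Finset.disjoint_left]
      intro j hj hj'
      simp only [K, Finset.mem_filter, Finset.mem_univ, true_and] at hj hj'
      obtain ⟨i, hi⟩ := hj
      obtain ⟨i', hi'⟩ := hj'
      exact hne (hcol _ _ _ _ _ hi hi')
    have h2 := Finset.card_le_univ (𝓕.biUnion K)
    rw [← h1, Fintype.card_fin] at h2
    exact_mod_cast h2
  -- Of the two factors `√(N f)`, one is at most `p * n` by the assumption to be refuted, and the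
  -- other is bounded by the mean of `R f` and `K f`. The `R f` are disjoint, and so are the `K f`,
  -- so the sum over labels is at most `p * n ^ 2`.
  have hN : ∀ f, ((N f).card : ℝ) ≤ p * n * (((R f).card + (K f).card) / 2) := by
    intro f
    have h0 : (0 : ℝ) ≤ (N f).card := by positivity
    have h1 : √((N f).card : ℝ) ≤ p * n := by
      refine Real.sqrt_le_iff.2 ⟨by positivity, ?_⟩
      have := hlt f
      rw [mul_pow]
      exact this.le
    have h2 : √((N f).card : ℝ) ≤ ((R f).card + (K f).card) / 2 := by
      refine Real.sqrt_le_iff.2 ⟨by positivity, (hNRK f).trans ?_⟩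
      nlinarith [sq_nonneg (((R f).card : ℝ) - (K f).card)]
    calc ((N f).card : ℝ) = √((N f).card : ℝ) * √((N f).card : ℝ) := (Real.mul_self_sqrt h0).symm
      _ ≤ _ := by gcongr
  have h1 : ((Finset.univ.filter fun ij : Fin n × Fin n => ∃ f, M f ij.1 ij.2).card : ℝ) ≤
      ∑ f ∈ 𝓕, ((N f).card : ℝ) := by
    exact_mod_cast (Finset.card_le_card hsub).trans Finset.card_biUnion_le
  have h2 : ∑ f ∈ 𝓕, ((N f).card : ℝ) ≤ p * n * n := by
    refine (Finset.sum_le_sum fun f _ => hN f).trans ?_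
    rw [← Finset.mul_sum, ← Finset.sum_div, Finset.sum_add_distrib]
    gcongr
    linarith
  nlinarith

end Matrix

/-! ### Random matchings and random choices -/

section RandomMatching

variable {n : ℕ} (P : Fin n → Fin n → Prop)

open Classical in
theorem sum_indicator_eq_card :
    ∑ i, ∑ j, (if P i j then (1 : ℝ) else 0) =
      (Finset.univ.filter fun ij : Fin n × Fin n => P ij.1 ij.2).card := by
  rw [← Fintype.sum_prod_type']
  simp

open Classical in
/-- A sparse set of pairs contains few of the pairs of a random matching. -/
theorem card_perm_sparse_le (hn : 0 < n) {p : ℝ} (hp : 0 ≤ p) :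
    ((Finset.univ.filter fun π : Equiv.Perm (Fin n) =>
      ((Finset.univ.filter fun ij : Fin n × Fin n => P ij.1 ij.2).card : ℝ) ≤ p * n ^ 2 ∧
        2 * p * n ≤ ((Finset.univ.filter fun i => P i (π i)).card : ℝ)).card : ℝ) ≤
      Real.exp (-(p ^ 2 * n / 8)) * Fintype.card (Equiv.Perm (Fin n)) := by
  refine le_trans (Nat.cast_le.2 (Finset.card_le_card fun π hπ => ?_))
    (card_perm_deviation_le (fun i j => if P i j then 1 else 0)
      (fun i j => by split_ifs <;> norm_num) (σ := 1) (by norm_num) hp)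
  simp only [Finset.mem_filter, Finset.mem_univ, true_and] at hπ ⊢
  obtain ⟨h1, h2⟩ := hπ
  have hn' : (0 : ℝ) < n := by exact_mod_cast hn
  rw [sum_indicator_eq_card, one_mul, Finset.sum_boole]
  have : ((Finset.univ.filter fun ij : Fin n × Fin n => P ij.1 ij.2).card : ℝ) / n ≤ p * n := by
    rw [div_le_iff₀ hn']; linarith
  linarith

open Classical in
/-- A dense set of pairs contains many of the pairs of a random matching. -/
theorem card_perm_dense_le (hn : 0 < n) {p : ℝ} (hp : 0 ≤ p) :
    ((Finset.univ.filter fun π : Equiv.Perm (Fin n) =>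
      p * n ^ 2 ≤ ((Finset.univ.filter fun ij : Fin n × Fin n => P ij.1 ij.2).card : ℝ) ∧
        ((Finset.univ.filter fun i => P i (π i)).card : ℝ) ≤ p * n / 2).card : ℝ) ≤
      Real.exp (-(p ^ 2 * n / 32)) * Fintype.card (Equiv.Perm (Fin n)) := by
  refine le_trans (Nat.cast_le.2 (Finset.card_le_card fun π hπ => ?_))
    ((card_perm_deviation_le (fun i j => if P i j then 1 else 0)
      (fun i j => by split_ifs <;> norm_num) (σ := -1) (by norm_num)
      (show 0 ≤ p / 2 by linarith)).trans (le_of_eq ?_))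
  · simp only [Finset.mem_filter, Finset.mem_univ, true_and] at hπ ⊢
    obtain ⟨h1, h2⟩ := hπ
    have hn' : (0 : ℝ) < n := by exact_mod_cast hn
    rw [sum_indicator_eq_card, Finset.sum_boole]
    have : p * n ≤ ((Finset.univ.filter fun ij : Fin n × Fin n => P ij.1 ij.2).card : ℝ) / n := by
      rw [le_div_iff₀ hn']; linarith
    linarith
  · congr 2; ring

open Classical in
theorem card_filter_perm_right (π : Equiv.Perm (Fin n)) :
    (Finset.univ.filter fun ij : Fin n × Fin n => P ij.1 (π ij.2)).card =
      (Finset.univ.filter fun ij : Fin n × Fin n => P ij.1 ij.2).card := by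
  refine Finset.card_bij (fun ij _ => (ij.1, π ij.2)) (by simp) ?_ ?_
  · rintro ⟨i, j⟩ _ ⟨i', j'⟩ _ h
    simpa using h
  · rintro ⟨i, j⟩ h
    exact ⟨(i, π.symm j), by simpa using h, by simp⟩

end RandomMatching

/-! ### Choices made in separate rounds, and lower bounds for uniform choices. -/

section RandomChoice

open Classical in
/-- Events that are certain or have probability at least `q` and depend on separate coordinates. -/
theorem card_filter_pi_own_le {k T : ℕ} {C : Type*} [Fintype C] (B : Finset (Fin k))
    (E : Fin k → (Fin T → C) → Prop) (own : Fin T → Fin k) {q : ℝ} (hq0 : 0 ≤ q) (hq1 : q ≤ 1)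
    (h : ∀ i ∈ B, (∀ ρ, E i ρ) ∨ ∃ τ, own τ = i ∧ ∃ D : C → Prop,
      q * Fintype.card C ≤ (Finset.univ.filter D).card ∧ ∀ ρ, D (ρ τ) → E i ρ) :
    ((Finset.univ.filter fun ρ : Fin T → C =>
      ((B.filter fun i => E i ρ).card : ℝ) ≤ q * B.card / 2).card : ℝ) ≤
      Real.exp (-(q * B.card / 20)) * Fintype.card (Fin T → C) := by
  set B₁ := B.filter fun i => ∀ ρ, E i ρ with hB₁
  set B₂ := B.filter fun i => ¬ ∀ ρ, E i ρ with hB₂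
  have hcard : (B₁.card : ℝ) + B₂.card = B.card := by
    exact_mod_cast Finset.card_filter_add_card_filter_not (s := B) fun i => ∀ ρ, E i ρ
  have h' : ∀ i : B₂, ∃ τ, own τ = i ∧ ∃ D : C → Prop,
      q * Fintype.card C ≤ (Finset.univ.filter D).card ∧ ∀ ρ, D (ρ τ) → E i ρ := by
    rintro ⟨i, hi⟩
    rw [hB₂, Finset.mem_filter] at hi
    exact (h i hi.1).resolve_left hi.2
  choose τ hτ D hD hE using h'
  set B' : Finset (Fin T) := Finset.univ.image τ with hB'
  -- Each round has one owner, so different indices use different rounds and their events are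
  -- independent.
  have hB'card : B'.card = B₂.card := by
    rw [hB', Finset.card_image_of_injective]
    · simp
    · intro i j hij
      exact Subtype.ext (by rw [← hτ i, ← hτ j, hij])
  obtain ⟨D', hD'⟩ : ∃ D' : Fin T → C → Prop, ∀ t x, D' t x ↔ ∃ i : B₂, τ i = t ∧ D i x :=
    ⟨_, fun _ _ => Iff.rfl⟩
  have key := card_filter_pi_le D' B' (q := q) (by
    intro t ht
    rw [hB', Finset.mem_image] at ht
    obtain ⟨i, -, rfl⟩ := ht
    refine (hD i).trans (Nat.cast_le.2 (Finset.card_le_card fun x hx => ?_))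
    simp only [Finset.mem_filter, Finset.mem_univ, true_and] at hx ⊢
    exact (hD' _ _).2 ⟨i, rfl, hx⟩)
  have hcount : ∀ ρ : Fin T → C, (B₁.card : ℝ) +
      (B'.filter fun t => D' t (ρ t)).card ≤ (B.filter fun i => E i ρ).card := by
    intro ρ
    have h1 : (B'.filter fun t => D' t (ρ t)).card ≤
        (B₂.filter fun i => E i ρ).card := by
      refine Finset.card_le_card_of_injOn own ?_ ?_
      · intro t ht
        rw [Finset.mem_coe, Finset.mem_filter, hD'] at ht
        obtain ⟨-, i, rfl, hi⟩ := ht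
        rw [Finset.mem_coe, Finset.mem_filter, hτ]
        exact ⟨i.2, hE i ρ hi⟩
      · intro t ht t' ht' htt'
        rw [Finset.mem_coe, Finset.mem_filter, hD'] at ht ht'
        obtain ⟨-, i, rfl, -⟩ := ht
        obtain ⟨-, i', rfl, -⟩ := ht'
        rw [hτ, hτ] at htt'
        rw [Subtype.ext htt']
    have h2 : B₁.card + (B₂.filter fun i => E i ρ).card ≤ (B.filter fun i => E i ρ).card := by
      rw [← Finset.card_union_of_disjoint]
      · refine Finset.card_le_card fun i hi => ?_
        rw [Finset.mem_union] at hi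
        rw [Finset.mem_filter]
        rcases hi with hi | hi
        · rw [hB₁, Finset.mem_filter] at hi
          exact ⟨hi.1, hi.2 ρ⟩
        · rw [Finset.mem_filter, hB₂, Finset.mem_filter] at hi
          exact ⟨hi.1.1, hi.2⟩
      · rw [Finset.disjoint_left]
        intro i hi hi'
        rw [hB₁, Finset.mem_filter] at hi
        rw [Finset.mem_filter, hB₂, Finset.mem_filter] at hi'
        exact hi'.1.2 hi.2
    exact_mod_cast (Nat.add_le_add_left h1 _).trans h2
  have hB0 : (0 : ℝ) ≤ B.card := by positivity
  have hB10 : (0 : ℝ) ≤ B₁.card := by positivity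
  -- If more than half of the events are certain they suffice. Otherwise at least half are random,
  -- which costs a factor `2` in the exponent.
  by_cases hbig : (B.card : ℝ) / 2 < B₁.card
  · have : (Finset.univ.filter fun ρ : Fin T → C =>
        ((B.filter fun i => E i ρ).card : ℝ) ≤ q * B.card / 2) = ∅ := by
      refine Finset.filter_eq_empty_iff.2 fun ρ _ hρ => ?_
      have h1 := hcount ρ
      have h2 : (0 : ℝ) ≤ (B'.filter fun t => D' t (ρ t)).card := by positivity
      nlinarith
    rw [this]
    simp only [Finset.card_empty, Nat.cast_zero]
    positivity
  · refine le_trans (Nat.cast_le.2 (Finset.card_le_card fun ρ hρ => ?_)) (key.trans ?_)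
    · simp only [Finset.mem_filter, Finset.mem_univ, true_and] at hρ ⊢
      have h1 := hcount ρ
      have h2 := mul_le_of_le_one_left hB10 hq1
      rw [hB'card]
      rw [← hcard, mul_add] at hρ
      linarith
    · rw [hB'card]
      have h2 := mul_le_mul_of_nonneg_left (show (B.card : ℝ) ≤ 2 * B₂.card by linarith) hq0
      refine mul_le_mul_of_nonneg_right (Real.exp_le_exp.2 ?_) (Nat.cast_nonneg _)
      linarith

variable {m : ℕ}

theorem card_vertex_le (m : ℕ) : Fintype.card (Vertex m) ≤ 2 * 2 ^ m := by
  have h : Function.Injective (fun v : Vertex m =>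
      (⟨⟨v.1.length, Nat.lt_succ_of_le v.2⟩, ⟨v.1, rfl⟩⟩ :
        Σ j : Fin (m + 1), List.Vector Bool j)) := by
    intro u v huv
    exact Subtype.ext (congrArg (fun s : Σ j : Fin (m + 1), List.Vector Bool j => s.2.1) huv)
  refine (Fintype.card_le_of_injective _ h).trans ?_
  rw [Fintype.card_sigma]
  simp only [card_vector, Fintype.card_bool]
  rw [Fin.sum_univ_eq_sum_range (fun j => 2 ^ j), ← pow_succ']
  exact (Nat.geomSum_lt le_rfl (by simp)).le

theorem card_inner_vertex_le {m : ℕ} (hm : 0 < m) :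
    (Finset.univ.filter fun v : Vertex m => v.1.length < m).card ≤ 2 ^ m := by
  obtain ⟨m, rfl⟩ := Nat.exists_eq_succ_of_ne_zero hm.ne'
  rw [pow_succ']
  refine le_trans ?_ (card_vertex_le m)
  rw [← Finset.card_univ]
  refine Finset.card_le_card_of_injOn
    (fun v => if h : v.1.length ≤ m then ⟨v.1, h⟩ else root m) (by simp) ?_
  intro u hu v hv huv
  simp only [Finset.coe_filter, Finset.mem_univ, true_and, Set.mem_ofPred_eq,
    Nat.lt_succ_iff] at hu hv
  simp only [hu, hv, dif_pos] at huv
  exact Subtype.ext (Subtype.mk.inj huv)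

open Classical in
/-- A uniformly random function agrees on `I` with a given one with probability `2 ^ (-|I|)`. -/
theorem card_agree_ge {V : Type*} [Fintype V] (g : V → Bool) (I : V → Prop) {K : ℕ}
    (hK : (Finset.univ.filter I).card ≤ K) :
    1 / (2 : ℝ) ^ K * Fintype.card (V → Bool) ≤
      (Finset.univ.filter fun g' : V → Bool => ∀ v, I v → g v = g' v).card := by
  have h : Fintype.card (V → Bool) ≤
      (Finset.univ.filter fun g' : V → Bool => ∀ v, I v → g v = g' v).card * 2 ^ K := by
    calc Fintype.card (V → Bool)
        ≤ ((Finset.univ.filter fun g' : V → Bool => ∀ v, I v → g v = g' v) ×ˢ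
          (Finset.univ : Finset ({v // I v} → Bool))).card := by
          rw [← Finset.card_univ]
          -- Overwriting a function by `g` on `I` loses nothing if its old values on `I` are
          -- recorded as well.
          refine Finset.card_le_card_of_injOn
            (fun g' => (fun v => if I v then g v else g' v, fun v => g' v.1)) ?_ ?_
          · intro g' _
            simp only [Finset.coe_product, Finset.coe_filter, Finset.mem_univ, true_and,
              Finset.coe_univ, Set.mem_prod, Set.mem_ofPred_eq, Set.mem_univ, and_true]
            intro v hv
            rw [if_pos hv]
          · intro g₁ _ g₂ _ h
            simp only [Prod.mk.injEq] at h
            funext v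
            by_cases hv : I v
            · exact congrFun h.2 ⟨v, hv⟩
            · simpa [hv] using congrFun h.1 v
      _ ≤ _ := by
          rw [Finset.card_product]
          refine Nat.mul_le_mul_left _ ?_
          rw [Finset.card_univ, Fintype.card_fun, Fintype.card_bool, Fintype.card_subtype]
          exact Nat.pow_le_pow_right (by norm_num) hK
  rw [one_div, inv_mul_le_iff₀ (by positivity), mul_comm]
  exact_mod_cast h

open Classical in
/-- A random rule selects a given candidate with the expected probability at least. -/
theorem card_chooser_ge [Fintype (Chooser m)] {C : Finset (Vertex m)} (hC : C.Nonempty)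
    {a : Vertex m} (ha : a ∈ C) :
    1 / (2 * (2 : ℝ) ^ m) * Fintype.card (Chooser m) ≤
      (Finset.univ.filter fun c : Chooser m => (c ⟨C, hC⟩).1 = a).card := by
  have h : Fintype.card (Chooser m) ≤
      (Finset.univ.filter fun c : Chooser m => (c ⟨C, hC⟩).1 = a).card * (2 * 2 ^ m) := by
    calc Fintype.card (Chooser m)
        ≤ ((Finset.univ.filter fun c : Chooser m => (c ⟨C, hC⟩).1 = a) ×ˢ
          (Finset.univ : Finset (Vertex m))).card := by
          rw [← Finset.card_univ]
          refine Finset.card_le_card_of_injOn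
            (fun c => (Function.update c ⟨C, hC⟩ ⟨a, ha⟩, (c ⟨C, hC⟩).1)) ?_ ?_
          · intro c _
            simp
          · intro c₁ _ c₂ _ h
            simp only [Prod.mk.injEq] at h
            funext s
            by_cases hs : s = ⟨C, hC⟩
            · subst hs; exact Subtype.ext h.2
            · have := congrFun h.1 s
              simpa [hs] using this
      _ ≤ _ := by
          rw [Finset.card_product, Finset.card_univ]
          exact Nat.mul_le_mul_left _ (card_vertex_le m)
  rw [one_div, inv_mul_le_iff₀ (by positivity), mul_comm]
  exact_mod_cast h

end RandomChoice

/-! ### Exchanging subtrees between the trees of the forest -/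

section Mixing

variable {X : Type*} {T m k : ℕ}

open Classical in
/-- The examples of tree `i`, with those of the subtree at `b` taken from tree `j`. -/
noncomputable def mixInput (b : Vertex m) (s : Fin T → Fin k × Leaf m) (i j : Fin k) :
    Fin T → Option (Leaf m) :=
  fun t => if (s t).1 = (if b.1 <:+ (s t).2.1 then j else i) then some (s t).2 else none

open Classical in
/-- The guesses of tree `i`, with those of the subtree at `b` taken from tree `j`. -/
noncomputable def mixGuess (b : Vertex m) (g : Fin k → Vertex m → Bool) (i j : Fin k) :
    Vertex m → Bool :=
  fun v => g (if b.1 <:+ v.1 then j else i) v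

open Classical in
/-- Permute the examples of the subtrees at `b` among the trees. -/
noncomputable def permAssign (b : Vertex m) (π : Equiv.Perm (Fin k))
    (s : Fin T → Fin k × Leaf m) : Fin T → Fin k × Leaf m :=
  -- Examples carry the name of their tree, while guesses are indexed by it. Hence `π.symm` here and
  -- `π` in `permGuess`: both give tree `j` the former subtree of tree `π j`.
  fun t => (if b.1 <:+ (s t).2.1 then π.symm (s t).1 else (s t).1, (s t).2)

open Classical in
/-- Permute the guesses of the subtrees at `b` among the trees. -/
noncomputable def permGuess (b : Vertex m) (π : Equiv.Perm (Fin k))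
    (g : Fin k → Vertex m → Bool) : Fin k → Vertex m → Bool :=
  fun i v => g (if b.1 <:+ v.1 then π i else i) v

theorem mixInput_permAssign (b : Vertex m) (π : Equiv.Perm (Fin k)) (s : Fin T → Fin k × Leaf m)
    (i j : Fin k) : mixInput b (permAssign b π s) i j = mixInput b s i (π j) := by
  funext t
  simp only [mixInput, permAssign]
  by_cases h : b.1 <:+ (s t).2.1
  · simp only [h, if_true, Equiv.symm_apply_eq]
  · simp only [h, if_false]

theorem mixGuess_permGuess (b : Vertex m) (π : Equiv.Perm (Fin k)) (g : Fin k → Vertex m → Bool)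
    (i j : Fin k) : mixGuess b (permGuess b π g) i j = mixGuess b g i (π j) := by
  funext v
  simp only [mixGuess, permGuess]
  by_cases h : b.1 <:+ v.1 <;> simp [h]

theorem mixInput_self (b : Vertex m) (s : Fin T → Fin k × Leaf m) (i : Fin k) (t : Fin T) :
    mixInput b s i i t = if (s t).1 = i then some (s t).2 else none := by
  simp [mixInput]

theorem mixGuess_self (b : Vertex m) (g : Fin k → Vertex m → Bool) (i : Fin k) :
    mixGuess b g i i = g i := by
  funext v
  simp [mixGuess]

/-- Permute the contents of the subtrees at `b` among the trees. -/
noncomputable def permSeed (b : Vertex m) (π : Equiv.Perm (Fin k)) (ω : Seed T k m) :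
    Seed T k m :=
  ⟨permAssign b π ω.assign, permGuess b π ω.guess, ω.chooser⟩

theorem permSeed_injective (b : Vertex m) (π : Equiv.Perm (Fin k)) :
    Function.Injective (permSeed (T := T) b π) := by
  refine Function.LeftInverse.injective (g := permSeed b π.symm) fun ω => ?_
  obtain ⟨s, g, ρ⟩ := ω
  simp only [permSeed, Seed.mk.injEq, and_true]
  constructor
  · funext t
    simp only [permAssign]
    by_cases h : b.1 <:+ (s t).2.1 <;> simp [h]
  · funext i v
    simp only [permGuess]
    by_cases h : b.1 <:+ v.1 <;> simp [h]

variable {A : Learner X} {pick : Fin T → Sample X → Sample X → X} {data : Fin T → X × Bool}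
  {v₀ : Fin k → Leaf m}

/-- Trees interact only through the assignment of examples. Mixing a tree with itself changes
nothing, so `b` is free and can later be taken to be `sib a`. -/
theorem forestState_eq_treeRun (ω : Seed T k m) (b : Vertex m) (n : ℕ) (i : Fin k) :
    forestState A pick v₀ data ω n i =
      treeRun A pick data (ω.guess i) ω.chooser (v₀ i) (mixInput b ω.assign i i) n := by
  induction n generalizing i with
  | zero => rfl
  | succ n ih =>
    rw [forestState, treeRun]
    by_cases h : n < T
    · rw [dif_pos h, dif_pos h, mixInput_self]
      by_cases hi : (ω.assign ⟨n, h⟩).1 = i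
      · subst hi
        simp only [Function.update_self, if_true, Option.elim_some, ih]
      · rw [Function.update_of_ne (Ne.symm hi), if_neg hi, ih]
        rfl
    · rw [dif_neg h, dif_neg h, ih]

/-- The pair of `a` and its sibling is eligible with the predictor `f`, after `n` rounds, in
tree `i` with the content of the subtree at the sibling of `a` taken from tree `j`. -/
def Entry (A : Learner X) (pick : Fin T → Sample X → Sample X → X) (data : Fin T → X × Bool)
    (v₀ : Fin k → Leaf m) (ρ₀ : Fin T → Chooser m) (n : ℕ) (a : Vertex m)
    (s : Fin T → Fin k × Leaf m) (g : Fin k → Vertex m → Bool) (f : X → Bool) (i j : Fin k) :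
    Prop :=
  Eligible A (v₀ i)
    (treeRun A pick data (mixGuess (sib a) g i j) ρ₀ (v₀ i) (mixInput (sib a) s i j) n) a f

variable {ρ₀ : Fin T → Chooser m} {n : ℕ} {a : Vertex m} {s : Fin T → Fin k × Leaf m}
  {g : Fin k → Vertex m → Bool}

theorem entry_permSeed (ω : Seed T k m) (π : Equiv.Perm (Fin k)) (f : X → Bool) (i j : Fin k) :
    Entry A pick data v₀ ρ₀ n a (permSeed (sib a) π ω).assign (permSeed (sib a) π ω).guess f i j ↔
      Entry A pick data v₀ ρ₀ n a ω.assign ω.guess f i (π j) := by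
  unfold Entry
  simp only [permSeed, mixInput_permAssign, mixGuess_permGuess]

theorem Eligible.not_covered {g : Vertex m → Bool} {ρ : Fin T → Chooser m} {v : Leaf m}
    {w : Fin T → Option (Leaf m)} {f : X → Bool}
    (h : Eligible A v (treeRun A pick data g ρ v w n) a f) :
    ¬ Covered (treeRun A pick data g ρ v w n).pertinent (parent a) := by
  refine (frontier_treeRun n).not_covered h.mem (parent_suffix a) ?_
  obtain ⟨b, p, hbp, rfl⟩ := vertex_ne_root_iff.1 h.ne_root
  simp [parent]

theorem not_sib_suffix (ha : a ≠ root m) {l : List Bool} (h : a.1 <:+ l) : ¬ (sib a).1 <:+ l := by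
  obtain ⟨b, p, hbp, rfl⟩ := vertex_ne_root_iff.1 ha
  intro h'
  have := cons_suffix_unique h h'
  simp at this

/-- Varying `j` changes only the subtree at `sib a`, and the predictor at `a` is computed inside the
subtree at `a` as long as their parent is uncovered. -/
theorem entry_row {f f' : X → Bool} {i j j' : Fin k} (h : Entry A pick data v₀ ρ₀ n a s g f i j)
    (h' : Entry A pick data v₀ ρ₀ n a s g f' i j') : f = f' := by
  have := agreeOn_treeRun (A := A) (pick := pick) (data := data) (ρ := ρ₀) (ρ' := ρ₀)
    (v₀ := v₀ i) (v₀' := v₀ i) (a := a) (g := mixGuess (sib a) g i j)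
    (g' := mixGuess (sib a) g i j') (w := mixInput (sib a) s i j) (w' := mixInput (sib a) s i j')
    h.ne_root ?_ ?_ n h.not_covered h'.not_covered
  · have h1 := this.predictor_eq (A := A) (List.suffix_refl _)
    rw [h.predictor_eq, h'.predictor_eq] at h1
    exact Option.some.inj h1
  · intro t l hl
    have hl' := not_sib_suffix h.ne_root hl
    simp only [mixInput]
    by_cases hs : (sib a).1 <:+ (s t).2.1
    · have hne : (s t).2 ≠ l := fun h => hl' (h ▸ hs)
      simp [hs, hne]
    · simp only [hs, if_false]
  · intro v hv
    simp only [mixGuess, not_sib_suffix h.ne_root hv, if_false]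

/-- Here `sib a` is the vertex whose subtree stays fixed. The initial output leaf varies with `i`,
but it influences neither pertinence nor samples. -/
theorem entry_col {f f' : X → Bool} {i i' j : Fin k} (h : Entry A pick data v₀ ρ₀ n a s g f i j)
    (h' : Entry A pick data v₀ ρ₀ n a s g f' i' j) : f = f' := by
  have := agreeOn_treeRun (A := A) (pick := pick) (data := data) (ρ := ρ₀) (ρ' := ρ₀)
    (v₀ := v₀ i) (v₀' := v₀ i') (a := sib a) (g := mixGuess (sib a) g i j)
    (g' := mixGuess (sib a) g i' j) (w := mixInput (sib a) s i j) (w' := mixInput (sib a) s i' j)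
    (sib_ne_root h.ne_root) ?_ ?_ n (by rw [parent_sib]; exact h.not_covered)
    (by rw [parent_sib]; exact h'.not_covered)
  · have h1 := this.predictor_eq (A := A) (List.suffix_refl _)
    rw [h.predictor_sib, h'.predictor_sib] at h1
    exact Option.some.inj h1
  · intro t l hl
    simp only [mixInput]
    by_cases hs : (sib a).1 <:+ (s t).2.1
    · simp only [hs, if_true]
    · have hne : (s t).2 ≠ l := fun h => hs (h ▸ hl)
      simp [hne]
  · intro v hv
    simp only [mixGuess, hv, if_true]

end Mixing

/-! ### The exceptional events -/

section Events

variable {X : Type*} {T m k : ℕ}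

/-- The three components of a seed. -/
def seedEquiv (T k m : ℕ) :
    Seed T k m ≃
      ((Fin T → Fin k × Leaf m) × (Fin k → Vertex m → Bool)) × (Fin T → Chooser m) where
  toFun ω := ((ω.assign, ω.guess), ω.chooser)
  invFun x := ⟨x.1.1, x.1.2, x.2⟩
  left_inv _ := rfl
  right_inv _ := rfl

/-- The assignments and choices on the one hand and the guesses on the other hand. -/
def seedEquivGuess (T k m : ℕ) :
    Seed T k m ≃
      ((Fin T → Fin k × Leaf m) × (Fin T → Chooser m)) × (Fin k → Vertex m → Bool) where
  toFun ω := ((ω.assign, ω.chooser), ω.guess)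
  invFun x := ⟨x.1.1, x.2, x.1.2⟩
  left_inv _ := rfl
  right_inv _ := rfl

open Classical in
noncomputable instance (T k m : ℕ) : Fintype (Seed T k m) :=
  Fintype.ofEquiv _ (seedEquiv T k m).symm

variable (A : Learner X) (pick : Fin T → Sample X → Sample X → X) (data : Fin T → X × Bool)
  (v₀ : Fin k → Leaf m) (ρ₀ : Fin T → Chooser m) (n : ℕ)

open Classical in
/-- The number of pairs of trees such that mixing them gives an eligible pair with predictor `f`. -/
noncomputable def pairCount (a : Vertex m) (s : Fin T → Fin k × Leaf m)
    (g : Fin k → Vertex m → Bool) (f : X → Bool) : ℕ :=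
  (Finset.univ.filter fun ij : Fin k × Fin k =>
    Entry A pick data v₀ ρ₀ n a s g f ij.1 ij.2).card

open Classical in
/-- The trees in which `a` and its sibling are eligible with the predictor `f`. -/
noncomputable def diag (a : Vertex m) (s : Fin T → Fin k × Leaf m)
    (g : Fin k → Vertex m → Bool) (f : X → Bool) : Finset (Fin k) :=
  Finset.univ.filter fun i => Entry A pick data v₀ ρ₀ n a s g f i i

open Classical in
/-- A predictor whose count is at least `K`, if there is one. -/
noncomputable def label (K : ℝ) (c : (X → Bool) → ℕ) : X → Bool :=
  if h : ∃ f, K ≤ (c f : ℝ) then h.choose else fun _ => false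

theorem le_label {K : ℝ} {c : (X → Bool) → ℕ} (h : ∃ f, K ≤ (c f : ℝ)) : K ≤ c (label K c) := by
  rw [label, dif_pos h]
  exact h.choose_spec

variable {A pick data v₀ ρ₀ n}

/-- Permuting the subtrees only permutes the columns of the matrix. Hence a label chosen from these
counts is not affected by the random matching. -/
theorem pairCount_permSeed (a : Vertex m) (π : Equiv.Perm (Fin k)) (ω : Seed T k m) :
    pairCount A pick data v₀ ρ₀ n a (permSeed (sib a) π ω).assign (permSeed (sib a) π ω).guess =
      pairCount A pick data v₀ ρ₀ n a ω.assign ω.guess := by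
  classical
  funext f
  unfold pairCount
  simp_rw [entry_permSeed]
  exact card_filter_perm_right (fun i j => Entry A pick data v₀ ρ₀ n a ω.assign ω.guess f i j) π

open Classical in
theorem card_few_eligible_le {d : ℕ} {H : Set (X → Bool)} {hs : X → Bool}
    (hA : HasMistakeBound A H d) (hsH : hs ∈ H) (hdm : d < m)
    (hpick : ∀ (t : Fin T) (S₁ S₂ : Sample X), A S₁ ≠ A S₂ →
      A S₁ (pick t S₁ S₂) ≠ A S₂ (pick t S₁ S₂))
    (hdata : ∀ t, hs (data t).1 = (data t).2) :
    ((Finset.univ.filter fun ω : Seed T k m =>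
      ((Finset.univ.filter fun i => ∃ a f,
        Entry A pick data v₀ ρ₀ n a ω.assign ω.guess f i i).card : ℝ) ≤
          1 / 2 ^ (2 ^ m) * k / 2).card : ℝ) ≤
      Real.exp (-(1 / 2 ^ (2 ^ m) * k / 10)) * Fintype.card (Seed T k m) := by
  refine card_filter_le_of_fibers (seedEquivGuess T k m) _ ?_
  rintro ⟨s, ρ⟩
  have hex := fun i => exists_guess_eligible (A := A) (pick := pick) (data := data) (ρ := ρ₀)
    (v₀ := v₀ i) (w := mixInput (root m) s i i) hA hsH hdm hpick hdata n
  choose g₀ hg₀ using hex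
  have key := card_filter_pi_le (fun i (g : Vertex m → Bool) =>
    ∀ u : Vertex m, u.1.length < m → g₀ i u = g u) (Finset.univ : Finset (Fin k))
    (q := 1 / 2 ^ (2 ^ m)) fun i _ => by
      convert card_agree_ge (g₀ i) (fun u : Vertex m => u.1.length < m) (K := 2 ^ m) ?_
      convert card_inner_vertex_le (m := m) (by omega)
  rw [Finset.card_univ, Fintype.card_fin] at key
  refine le_trans (Nat.cast_le.2 (Finset.card_le_card fun g hg => ?_))
    key
  have hg := (Finset.mem_filter.1 hg).2
  refine Finset.mem_filter.2 ⟨Finset.mem_univ _, ?_⟩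
  refine le_trans (Nat.cast_le.2 (Finset.card_le_card fun i hi => ?_)) hg
  simp only [Finset.mem_filter, Finset.mem_univ, true_and] at hi ⊢
  obtain ⟨a, f, haf⟩ := hg₀ i (g i) hi
  refine ⟨a, f, ?_⟩
  unfold Entry
  rw [mixGuess_self]
  have hw : mixInput (sib a) s i i = mixInput (root m) s i i := by
    funext t
    rw [mixInput_self, mixInput_self]
  change Eligible A (v₀ i) (treeRun A pick data (g i) ρ₀ (v₀ i) (mixInput (sib a) s i i) n) a f
  rw [hw]
  exact haf

open Classical in
-- Resampling a seed by a random permutation turns its diagonal into a random matching of a fixed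
-- matrix, with mean at most `p * k` when that matrix is sparse.
theorem card_sparse_le (hk : 0 < k) {p : ℝ} (hp : 0 ≤ p) (a : Vertex m) :
    ((Finset.univ.filter fun ω : Seed T k m =>
      ((Finset.univ.filter fun ij : Fin k × Fin k =>
        ∃ f, Entry A pick data v₀ ρ₀ n a ω.assign ω.guess f ij.1 ij.2).card : ℝ) ≤ p * k ^ 2 ∧
      2 * p * k ≤ ((Finset.univ.filter fun i =>
        ∃ f, Entry A pick data v₀ ρ₀ n a ω.assign ω.guess f i i).card : ℝ)).card : ℝ) ≤
      Real.exp (-(p ^ 2 * k / 8)) * Fintype.card (Seed T k m) := by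
  refine card_filter_le_of_maps (G := Equiv.Perm (Fin k)) (permSeed (sib a))
    (permSeed_injective (sib a)) _ fun ω => ?_
  have key := card_perm_sparse_le (fun i j =>
    ∃ f, Entry A pick data v₀ ρ₀ n a ω.assign ω.guess f i j) hk hp
  refine le_trans (Nat.cast_le.2 (Finset.card_le_card fun π hπ => ?_)) key
  have hπ := (Finset.mem_filter.1 hπ).2
  refine Finset.mem_filter.2 ⟨Finset.mem_univ _, ?_⟩
  simp_rw [entry_permSeed] at hπ
  rwa [card_filter_perm_right (fun i j =>
    ∃ f, Entry A pick data v₀ ρ₀ n a ω.assign ω.guess f i j) π] at hπ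

open Classical in
-- The same resampling, now for a single label. By `pairCount_permSeed` the label is constant along
-- the permutations, so one label suffices and no union bound over predictors is needed.
theorem card_dense_le (hk : 0 < k) {p : ℝ} (a : Vertex m) :
    ((Finset.univ.filter fun ω : Seed T k m =>
      p ^ 2 * k ^ 2 ≤ (pairCount A pick data v₀ ρ₀ n a ω.assign ω.guess
        (label (p ^ 2 * k ^ 2) (pairCount A pick data v₀ ρ₀ n a ω.assign ω.guess)) : ℝ) ∧
      ((diag A pick data v₀ ρ₀ n a ω.assign ω.guess
        (label (p ^ 2 * k ^ 2) (pairCount A pick data v₀ ρ₀ n a ω.assign ω.guess))).card : ℝ) ≤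
          p ^ 2 * k / 2).card : ℝ) ≤
      Real.exp (-((p ^ 2) ^ 2 * k / 32)) * Fintype.card (Seed T k m) := by
  refine card_filter_le_of_maps (G := Equiv.Perm (Fin k)) (permSeed (sib a))
    (permSeed_injective (sib a)) _ fun ω => ?_
  have key := card_perm_dense_le (fun i j =>
    Entry A pick data v₀ ρ₀ n a ω.assign ω.guess
      (label (p ^ 2 * k ^ 2) (pairCount A pick data v₀ ρ₀ n a ω.assign ω.guess)) i j) hk
      (sq_nonneg p)
  refine le_trans (Nat.cast_le.2 (Finset.card_le_card fun π hπ => ?_)) key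
  have hπ := (Finset.mem_filter.1 hπ).2
  refine Finset.mem_filter.2 ⟨Finset.mem_univ _, ?_⟩
  rw [pairCount_permSeed] at hπ
  unfold diag at hπ
  simp_rw [entry_permSeed] at hπ
  exact hπ

/-- The output vertex of tree `i`. -/
noncomputable def outVertex (A : Learner X) (pick : Fin T → Sample X → Sample X → X)
    (data : Fin T → X × Bool) (v₀ : Fin k → Leaf m) (n : ℕ) (ω : Seed T k m) (i : Fin k) :
    Vertex m :=
  (forestState A pick v₀ data ω n i).out

open Classical in
-- With assignments and guesses fixed, `diag` and the label are constants, since `Entry` uses the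
-- auxiliary choices `ρ₀`. Only the output choices remain random, and a tree owns the rounds whose
-- examples it receives.
theorem card_few_out_le {K : ℝ} (a : Vertex m)
    (f : (Fin T → Fin k × Leaf m) → (Fin k → Vertex m → Bool) → X → Bool) :
    ((Finset.univ.filter fun ω : Seed T k m =>
      K < ((diag A pick data v₀ ρ₀ n a ω.assign ω.guess (f ω.assign ω.guess)).card : ℝ) ∧
      (((diag A pick data v₀ ρ₀ n a ω.assign ω.guess (f ω.assign ω.guess)).filter fun i =>
        outVertex A pick data v₀ n ω i = a).card : ℝ) ≤ 1 / (2 * 2 ^ m) *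
          (diag A pick data v₀ ρ₀ n a ω.assign ω.guess (f ω.assign ω.guess)).card / 2).card : ℝ) ≤
      Real.exp (-(1 / (2 * 2 ^ m) * K / 20)) * Fintype.card (Seed T k m) := by
  refine card_filter_le_of_fibers (seedEquiv T k m) _ ?_
  rintro ⟨s, g⟩
  obtain ⟨B, hB⟩ : ∃ B, B = diag A pick data v₀ ρ₀ n a s g (f s g) := ⟨_, rfl⟩
  by_cases hK : K < B.card
  · have hq1 : 1 / (2 * (2 : ℝ) ^ m) ≤ 1 := by
      rw [div_le_one (by positivity)]
      have := one_le_pow₀ (a := (2 : ℝ)) (n := m) (by norm_num)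
      linarith
    have key := card_filter_pi_own_le B
      (fun i ρ => outVertex A pick data v₀ n ⟨s, g, ρ⟩ i = a) (fun t => (s t).1)
      (q := 1 / (2 * 2 ^ m)) (by positivity) hq1 ?_
    · refine le_trans (Nat.cast_le.2 (Finset.card_le_card fun ρ hρ => ?_)) (key.trans ?_)
      · refine Finset.mem_filter.2 ⟨Finset.mem_univ _, ?_⟩
        have h := (Finset.mem_filter.1 hρ).2.2
        rw [hB]
        refine le_trans (Nat.cast_le.2 (Finset.card_le_card fun i hi => ?_)) h
        simp only [Finset.mem_filter] at hi ⊢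
        exact hi
      · refine le_of_le_of_eq (mul_le_mul_of_nonneg_right (Real.exp_le_exp.2 ?_)
          (Nat.cast_nonneg _)) (by congr!)
        have : 1 / (2 * (2 : ℝ) ^ m) * K ≤ 1 / (2 * (2 : ℝ) ^ m) * B.card :=
          mul_le_mul_of_nonneg_left hK.le (by positivity)
        linarith
    · intro i hi
      simp only [hB, diag, Finset.mem_filter, Finset.mem_univ, true_and] at hi
      have hout : ∀ ρ, outVertex A pick data v₀ n ⟨s, g, ρ⟩ i =
          (treeRun A pick data (mixGuess (sib a) g i i) ρ (v₀ i) (mixInput (sib a) s i i) n).out := by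
        intro ρ
        rw [outVertex, forestState_eq_treeRun _ (sib a), mixGuess_self]
      simp_rw [hout]
      rcases Eligible.out hi with h | ⟨τ, hτ, C, hC, haC, h⟩
      · exact Or.inl h
      · refine Or.inr ⟨τ, ?_, fun c => (c ⟨C, hC⟩).1 = a, ?_, ?_⟩
        · rw [mixInput_self] at hτ
          by_contra hne
          rw [if_neg hne] at hτ
          simp at hτ
        · refine le_trans (card_chooser_ge hC haC)
            (Nat.cast_le.2 (Finset.card_le_card fun c hc => ?_))
          simp only [Finset.mem_filter] at hc ⊢
          exact hc
        · intro ρ hρ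
          rw [h, hρ]
  · rw [Finset.filter_eq_empty_iff.2 fun ρ _ hρ => hK (hB ▸ hρ.1)]
    simp only [Finset.card_empty, Nat.cast_zero]
    positivity

/-- An output vertex at an eligible pair outputs its predictor. -/
theorem output_of_entry {ω : Seed T k m} {a : Vertex m} {f : X → Bool} {i : Fin k}
    (h : Entry A pick data v₀ ρ₀ n a ω.assign ω.guess f i i)
    (hout : outVertex A pick data v₀ n ω i = a) :
    predictor A (forestState A pick v₀ data ω n i) (forestState A pick v₀ data ω n i).out =
      some f := by
  rw [outVertex] at hout
  rw [hout, forestState_eq_treeRun _ (sib a)]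
  unfold Entry at h
  rw [mixGuess_self] at h
  exact (h.of_core (treeRun_core n)).predictor_eq

end Events

/-! ### A frequent predictor in a fixed round -/

section Frequent

variable {X : Type*} {T m k : ℕ}

theorem seedLaw_real (Q : Seed T k m → Prop) [DecidablePred Q] :
    (seedLaw T k m).real {ω | Q ω} =
      (Finset.univ.filter Q).card / Fintype.card (Seed T k m) := by
  rw [seedLaw, measureReal_def, uniformOn_univ, ENNReal.toReal_div]
  congr 1
  rw [← Finset.coe_filter_univ, Measure.count_apply_finset]
  simp

open Classical in
theorem freq_eq_card {α : Type*} (L : Fin k → α) (x : α) :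
    freq L x = ((Finset.univ.filter fun i => L i = x).card : ℝ) / k := by
  unfold freq
  rw [Finset.sum_boole, one_div, inv_mul_eq_div]

variable {A : Learner X} {pick : Fin T → Sample X → Sample X → X} {data : Fin T → X × Bool}
  {v₀ : Fin k → Leaf m} {ρ₀ : Fin T → Chooser m} {n : ℕ}

open Classical in
/-- Outside the exceptional events, some predictor is frequent. -/
theorem exists_frequent_output (hk : 0 < k) (hx : (2 : ℝ) ^ 10 * (2 ^ m) ^ 4 ≤ 2 ^ (2 ^ m)) {p : ℝ}
    (hp : p = 1 / (8 * 2 ^ m * 2 ^ (2 ^ m))) (ω : Seed T k m)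
    (h1 : 1 / 2 ^ (2 ^ m) * k / 2 < ((Finset.univ.filter fun i => ∃ a f,
        Entry A pick data v₀ ρ₀ n a ω.assign ω.guess f i i).card : ℝ))
    (h2 : ∀ a, ¬ (((Finset.univ.filter fun ij : Fin k × Fin k =>
        ∃ f, Entry A pick data v₀ ρ₀ n a ω.assign ω.guess f ij.1 ij.2).card : ℝ) ≤ p * k ^ 2 ∧
      2 * p * k ≤ ((Finset.univ.filter fun i =>
        ∃ f, Entry A pick data v₀ ρ₀ n a ω.assign ω.guess f i i).card : ℝ)))
    (h3 : ∀ a, ¬ (p ^ 2 * k ^ 2 ≤ (pairCount A pick data v₀ ρ₀ n a ω.assign ω.guess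
        (label (p ^ 2 * k ^ 2) (pairCount A pick data v₀ ρ₀ n a ω.assign ω.guess)) : ℝ) ∧
      ((diag A pick data v₀ ρ₀ n a ω.assign ω.guess
        (label (p ^ 2 * k ^ 2) (pairCount A pick data v₀ ρ₀ n a ω.assign ω.guess))).card : ℝ) ≤
          p ^ 2 * k / 2))
    (h4 : ∀ a, ¬ (p ^ 2 * k / 2 < ((diag A pick data v₀ ρ₀ n a ω.assign ω.guess
        (label (p ^ 2 * k ^ 2) (pairCount A pick data v₀ ρ₀ n a ω.assign ω.guess))).card : ℝ) ∧
      (((diag A pick data v₀ ρ₀ n a ω.assign ω.guess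
        (label (p ^ 2 * k ^ 2) (pairCount A pick data v₀ ρ₀ n a ω.assign ω.guess))).filter fun i =>
        outVertex A pick data v₀ n ω i = a).card : ℝ) ≤ 1 / (2 * 2 ^ m) *
          (diag A pick data v₀ ρ₀ n a ω.assign ω.guess
            (label (p ^ 2 * k ^ 2)
              (pairCount A pick data v₀ ρ₀ n a ω.assign ω.guess))).card / 2)) :
    ∃ f : X → Bool, eta (2 ^ m) ≤ freq (fun i => predictor A (forestState A pick v₀ data ω n i)
      (forestState A pick v₀ data ω n i).out) (some f) := by
  have hx2 : (2 : ℝ) ^ (4 * 2 ^ m + 2) = 4 * (2 ^ (2 ^ m)) ^ 4 := by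
    rw [pow_add, mul_comm 4, pow_mul]; ring
  have hK : (1 : ℝ) ≤ 2 ^ m := one_le_pow₀ (by norm_num)
  have hVK : (Fintype.card (Vertex m) : ℝ) ≤ 2 * 2 ^ m := by exact_mod_cast card_vertex_le m
  have heta : eta (2 ^ m) = 1 / (4 * (2 ^ (2 ^ m)) ^ 4 * 2 ^ m) := by
    rw [eta, hx2]; push_cast; rfl
  rw [heta]
  have hk' : (0 : ℝ) < k := by exact_mod_cast hk
  generalize (2 : ℝ) ^ (2 ^ m) = x at *
  generalize (2 : ℝ) ^ m = K at *
  have hK0 : 0 < K := by linarith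
  have hx0 : 0 < x := lt_of_lt_of_le (by positivity) hx
  have hp0 : 0 < p := by rw [hp]; positivity
  -- Pigeonhole over at most `2 * K` vertices; `p` is such that `2 * K * (2 * p * k)` equals the
  -- lower bound in `h1`.
  obtain ⟨a, ha⟩ : ∃ a, 2 * p * k ≤ ((Finset.univ.filter fun i =>
      ∃ f, Entry A pick data v₀ ρ₀ n a ω.assign ω.guess f i i).card : ℝ) := by
    by_contra! hlt
    have hle : ((Finset.univ.filter fun i => ∃ a f,
        Entry A pick data v₀ ρ₀ n a ω.assign ω.guess f i i).card : ℝ) ≤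
        ∑ a : Vertex m, ((Finset.univ.filter fun i =>
          ∃ f, Entry A pick data v₀ ρ₀ n a ω.assign ω.guess f i i).card : ℝ) := by
      norm_cast
      refine le_trans (Finset.card_le_card fun i hi => ?_) Finset.card_biUnion_le
      obtain ⟨a, f, haf⟩ := (Finset.mem_filter.1 hi).2
      exact Finset.mem_biUnion.2 ⟨a, Finset.mem_univ _,
        Finset.mem_filter.2 ⟨Finset.mem_univ _, f, haf⟩⟩
    have hsum : ∑ a : Vertex m, ((Finset.univ.filter fun i =>
          ∃ f, Entry A pick data v₀ ρ₀ n a ω.assign ω.guess f i i).card : ℝ) ≤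
          ∑ a : Vertex m, 2 * p * k := Finset.sum_le_sum fun a _ => (hlt a).le
    rw [Finset.sum_const, Finset.card_univ, nsmul_eq_mul] at hsum
    have h5 : (Fintype.card (Vertex m) : ℝ) * (2 * p * k) ≤ 2 * K * (2 * p * k) := by gcongr
    have h6 : 2 * K * (2 * p * k) = 1 / x * k / 2 := by
      rw [hp]; field_simp; norm_num
    linarith
  have hsparse : p * k ^ 2 < ((Finset.univ.filter fun ij : Fin k × Fin k =>
      ∃ f, Entry A pick data v₀ ρ₀ n a ω.assign ω.guess f ij.1 ij.2).card : ℝ) := by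
    by_contra! hle
    exact h2 a ⟨hle, ha⟩
  have hlabel := le_label (exists_frequent_label
    (fun f i j => Entry A pick data v₀ ρ₀ n a ω.assign ω.guess f i j)
    (fun _ _ _ _ _ => entry_row) (fun _ _ _ _ _ => entry_col) hp0.le hsparse)
  change _ ≤ ((pairCount A pick data v₀ ρ₀ n a ω.assign ω.guess
        (label (p ^ 2 * k ^ 2) (pairCount A pick data v₀ ρ₀ n a ω.assign ω.guess)) : ℕ) : ℝ)
    at hlabel
  specialize h3 a
  specialize h4 a
  generalize label (p ^ 2 * k ^ 2) (pairCount A pick data v₀ ρ₀ n a ω.assign ω.guess) = f at *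
  have hdense : p ^ 2 * k / 2 < ((diag A pick data v₀ ρ₀ n a ω.assign ω.guess f).card : ℝ) := by
    by_contra! hle
    exact h3 ⟨hlabel, hle⟩
  have hout : 1 / (2 * K) * (diag A pick data v₀ ρ₀ n a ω.assign ω.guess f).card / 2 <
      (((diag A pick data v₀ ρ₀ n a ω.assign ω.guess f).filter fun i =>
        outVertex A pick data v₀ n ω i = a).card : ℝ) := by
    by_contra! hle
    exact h4 ⟨hdense, hle⟩
  refine ⟨f, ?_⟩
  rw [freq_eq_card, le_div_iff₀ hk']
  have h5 : 1 / (2 * K) * (p ^ 2 * k / 2) / 2 ≤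
      1 / (2 * K) * (diag A pick data v₀ ρ₀ n a ω.assign ω.guess f).card / 2 := by gcongr
  -- The count obtained is `k / (512 * K ^ 3 * x ^ 2)`, far above the threshold because `x`
  -- dominates every small power of `K`.
  have h6 : 1 / (4 * x ^ 4 * K) * k ≤ 1 / (2 * K) * (p ^ 2 * k / 2) / 2 := by
    have h7 : 1 / (2 * K) * (p ^ 2 * k / 2) / 2 = 1 / (512 * K ^ 3 * x ^ 2) * k := by
      rw [hp]; field_simp; norm_num
    rw [h7]
    gcongr 1 / ?_ * _
    have h8 : K ≤ K ^ 4 := by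
      calc K = K ^ 1 := (pow_one K).symm
        _ ≤ K ^ 4 := pow_le_pow_right₀ hK (by norm_num)
    have h9 : 128 * K ^ 2 ≤ x ^ 2 := by
      calc 128 * K ^ 2 ≤ (2 ^ 10 * K) ^ 2 := by nlinarith [sq_nonneg K]
        _ ≤ x ^ 2 := by
          gcongr
          linarith
    calc 512 * K ^ 3 * x ^ 2 = 4 * K * x ^ 2 * (128 * K ^ 2) := by ring
      _ ≤ 4 * K * x ^ 2 * x ^ 2 := by gcongr
      _ = _ := by ring
  refine h6.trans (h5.trans (hout.le.trans (Nat.cast_le.2 (Finset.card_le_card fun i hi => ?_))))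
  simp only [diag, Finset.mem_filter, Finset.mem_univ, true_and] at hi ⊢
  exact output_of_entry hi.1 hi.2

/-- The union bound over one exceptional event and three families of them. -/
theorem card_filter_not_le_of_exceptions {Ω V : Type*} [Fintype Ω] [Fintype V]
    {Q₁ R : Ω → Prop} {Q₂ Q₃ Q₄ : V → Ω → Prop} {d₁ : DecidablePred Q₁}
    {d₂ : ∀ a, DecidablePred (Q₂ a)} {d₃ : ∀ a, DecidablePred (Q₃ a)}
    {d₄ : ∀ a, DecidablePred (Q₄ a)} {dR : DecidablePred fun ω => ¬ R ω} {c K : ℝ}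
    (hc : 0 ≤ c) (hK : 1 ≤ K) (hVK : (Fintype.card V : ℝ) ≤ 2 * K)
    (b1 : ((Finset.univ.filter Q₁).card : ℝ) ≤ c)
    (b2 : ∀ a, ((Finset.univ.filter (Q₂ a)).card : ℝ) ≤ c)
    (b3 : ∀ a, ((Finset.univ.filter (Q₃ a)).card : ℝ) ≤ c)
    (b4 : ∀ a, ((Finset.univ.filter (Q₄ a)).card : ℝ) ≤ c)
    (hR : ∀ ω, ¬ Q₁ ω → (∀ a, ¬ Q₂ a ω) → (∀ a, ¬ Q₃ a ω) → (∀ a, ¬ Q₄ a ω) → R ω) :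
    ((Finset.univ.filter fun ω => ¬ R ω).card : ℝ) ≤ 7 * K * c := by
  classical
  have hsub : (Finset.univ.filter fun ω => ¬ R ω) ⊆ Finset.univ.filter Q₁ ∪
      Finset.univ.biUnion fun a => (Finset.univ.filter (Q₂ a) ∪ Finset.univ.filter (Q₃ a) ∪
        Finset.univ.filter (Q₄ a)) := by
    intro ω hω
    simp only [Finset.mem_union, Finset.mem_biUnion, Finset.mem_filter, Finset.mem_univ,
      true_and] at hω ⊢
    by_contra! hcon
    exact hω (hR ω hcon.1 (fun a => (hcon.2 a).1.1) (fun a => (hcon.2 a).1.2)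
      fun a => (hcon.2 a).2)
  have hle : (Finset.univ.filter fun ω => ¬ R ω).card ≤ (Finset.univ.filter Q₁).card +
      ∑ a, ((Finset.univ.filter (Q₂ a)).card + (Finset.univ.filter (Q₃ a)).card +
        (Finset.univ.filter (Q₄ a)).card) := by
    refine (Finset.card_le_card hsub).trans ((Finset.card_union_le _ _).trans ?_)
    refine Nat.add_le_add_left (Finset.card_biUnion_le.trans (Finset.sum_le_sum fun a _ => ?_)) _
    exact (Finset.card_union_le _ _).trans (Nat.add_le_add_right (Finset.card_union_le _ _) _)
  have hle' : ((Finset.univ.filter fun ω => ¬ R ω).card : ℝ) ≤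
      (Finset.univ.filter Q₁).card +
      ∑ a, (((Finset.univ.filter (Q₂ a)).card : ℝ) + (Finset.univ.filter (Q₃ a)).card +
        (Finset.univ.filter (Q₄ a)).card) := by exact_mod_cast hle
  have hsum : ∑ a, (((Finset.univ.filter (Q₂ a)).card : ℝ) + (Finset.univ.filter (Q₃ a)).card +
        (Finset.univ.filter (Q₄ a)).card) ≤ ∑ a : V, 3 * c :=
    Finset.sum_le_sum fun a _ => by linarith [b2 a, b3 a, b4 a]
  rw [Finset.sum_const, Finset.card_univ, nsmul_eq_mul] at hsum
  have h5 : (Fintype.card V : ℝ) * (3 * c) ≤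
      2 * K * (3 * c) := by gcongr
  have h6 : 1 * c ≤ K * c := by gcongr
  linarith

/-- If each of `T` events fails with probability at most `δ`, then all of them occur with
probability at least `1 - T * δ`. -/
theorem one_sub_le_of_forall {Ω : Type*} [Fintype Ω] [Nonempty Ω] {T : ℕ} {R : Fin T → Ω → Prop}
    {dR : ∀ t, DecidablePred fun ω => ¬ R t ω} {dA : DecidablePred fun ω => ∀ t, R t ω} {δ β : ℝ}
    (h : ∀ t, ((Finset.univ.filter fun ω => ¬ R t ω).card : ℝ) ≤ δ * Fintype.card Ω)
    (hβ : T * δ ≤ β) :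
    1 - β ≤ ((Finset.univ.filter fun ω => ∀ t, R t ω).card : ℝ) / Fintype.card Ω := by
  classical
  have hN : (0 : ℝ) < Fintype.card Ω := by exact_mod_cast Fintype.card_pos
  have hcover : (Finset.univ : Finset Ω) ⊆ (Finset.univ.filter fun ω => ∀ t, R t ω) ∪
      Finset.univ.biUnion fun t => Finset.univ.filter fun ω => ¬ R t ω := by
    intro ω _
    simp only [Finset.mem_union, Finset.mem_biUnion, Finset.mem_filter, Finset.mem_univ, true_and]
    by_cases hω : ∀ t, R t ω
    · exact Or.inl hω
    · exact Or.inr (not_forall.1 hω)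
  have hle : Fintype.card Ω ≤ (Finset.univ.filter fun ω => ∀ t, R t ω).card +
      ∑ t, (Finset.univ.filter fun ω => ¬ R t ω).card := by
    rw [← Finset.card_univ]
    exact (Finset.card_le_card hcover).trans ((Finset.card_union_le _ _).trans
      (Nat.add_le_add_left Finset.card_biUnion_le _))
  have hle' : (Fintype.card Ω : ℝ) ≤ (Finset.univ.filter fun ω => ∀ t, R t ω).card +
      ∑ t, ((Finset.univ.filter fun ω => ¬ R t ω).card : ℝ) := by exact_mod_cast hle
  have hsum := Finset.sum_le_sum fun t (_ : t ∈ Finset.univ) => h t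
  rw [Finset.sum_const, Finset.card_univ, Fintype.card_fin, nsmul_eq_mul, ← mul_assoc] at hsum
  have := mul_le_mul_of_nonneg_right hβ hN.le
  rw [le_div_iff₀ hN]
  linarith

open Classical in
theorem card_not_frequent_le {d : ℕ} {H : Set (X → Bool)} {hs : X → Bool}
    (hA : HasMistakeBound A H d) (hsH : hs ∈ H) (hdm : d < m)
    (hpick : ∀ (t : Fin T) (S₁ S₂ : Sample X), A S₁ ≠ A S₂ →
      A S₁ (pick t S₁ S₂) ≠ A S₂ (pick t S₁ S₂))
    (hdata : ∀ t, hs (data t).1 = (data t).2) (hk : 0 < k)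
    (hx : (2 : ℝ) ^ 10 * (2 ^ m) ^ 4 ≤ 2 ^ (2 ^ m)) {p : ℝ}
    (hp : p = 1 / (8 * 2 ^ m * 2 ^ (2 ^ m))) (n : ℕ) :
    ((Finset.univ.filter fun ω : Seed T k m => ¬ ∃ f : X → Bool,
      eta (2 ^ m) ≤ freq (fun i => predictor A (forestState A pick v₀ data ω n i)
      (forestState A pick v₀ data ω n i).out) (some f)).card : ℝ) ≤
      7 * 2 ^ m * Real.exp (-(p ^ 4 * k / 32)) * Fintype.card (Seed T k m) := by
  obtain ⟨ρ₀⟩ : Nonempty (Fin T → Chooser m) :=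
    ⟨fun _ s => ⟨s.2.choose, s.2.choose_spec⟩⟩
  have hK : (1 : ℝ) ≤ 2 ^ m := one_le_pow₀ (by norm_num)
  have hVK : (Fintype.card (Vertex m) : ℝ) ≤ 2 * 2 ^ m := by exact_mod_cast card_vertex_le m
  have hx1 : (1 : ℝ) ≤ 2 ^ (2 ^ m) := one_le_pow₀ (by norm_num)
  have hp0 : 0 < p := by rw [hp]; positivity
  have hpK : p ≤ 1 / (8 * 2 ^ m) := by
    rw [hp]
    refine one_div_le_one_div_of_le (by positivity) ?_
    exact le_mul_of_one_le_right (by positivity) hx1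
  have hp1 : p ≤ 1 / 8 := hpK.trans
    (one_div_le_one_div_of_le (by norm_num) (by linarith))
  have hc0 : 1 / (2 : ℝ) ^ (2 ^ m) = 8 * 2 ^ m * p := by
    rw [hp]; field_simp
  have b1 := card_few_eligible_le (A := A) (pick := pick) (data := data) (v₀ := v₀) (ρ₀ := ρ₀)
    (n := n) hA hsH hdm hpick hdata
  have b2 := fun a => card_sparse_le (A := A) (pick := pick) (data := data) (v₀ := v₀) (ρ₀ := ρ₀)
    (n := n) hk hp0.le a
  have b3 := fun a => card_dense_le (A := A) (pick := pick) (data := data) (v₀ := v₀) (ρ₀ := ρ₀)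
    (n := n) (p := p) hk a
  have b4 := fun a => card_few_out_le (A := A) (pick := pick) (data := data) (v₀ := v₀) (ρ₀ := ρ₀)
    (n := n) (K := p ^ 2 * k / 2) a
    (fun s g => label (p ^ 2 * k ^ 2) (pairCount A pick data v₀ ρ₀ n a s g))
  have hdet := fun ω => exists_frequent_output (A := A) (pick := pick) (data := data) (v₀ := v₀)
    (ρ₀ := ρ₀) (n := n) hk hx hp ω
  set N : ℝ := (Fintype.card (Seed T k m) : ℝ) with hN
  set E : ℝ := p ^ 4 * k / 32 with hE
  have hk0 : (0 : ℝ) ≤ k := by positivity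
  have hp4 : p ^ 4 ≤ p ^ 2 := pow_le_pow_of_le_one hp0.le (by linarith) (by norm_num)
  have hp41 : p ^ 4 ≤ p := by
    calc p ^ 4 ≤ p ^ 1 := pow_le_pow_of_le_one hp0.le (by linarith) (by norm_num)
      _ = p := pow_one p
  -- The smallest guaranteed exponent, `E`, is that of the dense event; all other bounds are
  -- weakened to it.
  have mono : ∀ {c y : ℝ}, c ≤ Real.exp (-y) * N → E ≤ y → c ≤ Real.exp (-E) * N := by
    intro c y h h'
    refine h.trans (mul_le_mul_of_nonneg_right (Real.exp_le_exp.2 (by linarith)) ?_)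
    rw [hN]; positivity
  have e1 : E ≤ 1 / 2 ^ (2 ^ m) * k / 10 := by
    rw [hc0, hE]
    have : p ^ 4 * k ≤ p * k := by gcongr
    have : 1 * (p * k) ≤ 2 ^ m * (p * k) := by gcongr
    have : 0 ≤ p * k := by positivity
    linarith
  have e2 : E ≤ p ^ 2 * k / 8 := by
    rw [hE]
    have : p ^ 4 * k ≤ p ^ 2 * k := by gcongr
    have : 0 ≤ p ^ 2 * k := by positivity
    linarith
  have e3 : E ≤ (p ^ 2) ^ 2 * k / 32 := le_of_eq (by rw [hE]; ring)
  have e4 : E ≤ 1 / (2 * 2 ^ m) * (p ^ 2 * k / 2) / 20 := by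
    rw [hE]
    have h1 : p * p ≤ 1 / 8 * (1 / (8 * 2 ^ m)) :=
      mul_le_mul hp1 hpK hp0.le (by norm_num)
    have h2 : p ^ 4 * k ≤ 1 / 8 * (1 / (8 * 2 ^ m)) * (p ^ 2 * k) := by
      calc p ^ 4 * k = p * p * (p ^ 2 * k) := by ring
        _ ≤ _ := by gcongr
    have h3 : 1 / (2 * 2 ^ m) * (p ^ 2 * k / 2) / 20 = 1 / 2 ^ m * (p ^ 2 * k) / 80 := by
      field_simp; norm_num
    have h4 : 1 / 8 * (1 / (8 * 2 ^ m)) * (p ^ 2 * k) = 1 / 2 ^ m * (p ^ 2 * k) / 64 := by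
      field_simp; norm_num
    have h5 : 0 ≤ 1 / 2 ^ m * (p ^ 2 * k) := by positivity
    rw [h3]
    rw [h4] at h2
    linarith
  have b1 := mono b1 e1
  have b2 := fun a => mono (b2 a) e2
  have b3 := fun a => mono (b3 a) e3
  have b4 := fun a => mono (b4 a) e4
  clear mono e1 e2 e3 e4
  rw [mul_assoc]
  exact card_filter_not_le_of_exceptions (by rw [hN]; positivity) hK hVK b1 b2 b3 b4
    fun ω c1 c2 c3 c4 => hdet ω (not_le.1 c1) c2 c3 c4

end Frequent

/-! ### Numerical estimates -/

section Numbers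

theorem ten_add_four_mul_le_two_pow {m : ℕ} (hm : 5 ≤ m) : 10 + 4 * m ≤ 2 ^ m := by
  induction m, hm using Nat.le_induction with
  | base => norm_num
  | succ m hm ih => rw [pow_succ]; omega

theorem tail_bound {K x N T β p : ℝ} (hK : 32 ≤ K) (hx : 2 ^ 10 * K ^ 4 ≤ x) (hT : 1 ≤ T)
    (hβ : 0 < β) (hβ1 : β < 1) (hp : p = 1 / (8 * K * x))
    (hN : 64 * x ^ 8 * K ^ 2 * Real.log (5 * T * Real.log K / β) ≤ N) :
    T * (7 * K * Real.exp (-(p ^ 4 * N / 32))) ≤ β := by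
  have hK0 : 0 < K := by linarith
  have hx0 : 0 < x := lt_of_lt_of_le (by positivity) hx
  have hlogK : 1 ≤ Real.log K := by
    rw [Real.le_log_iff_exp_le hK0]
    have := Real.exp_one_lt_d9
    linarith
  set r := 5 * T * Real.log K / β with hr
  have hr5 : 5 ≤ r := by
    rw [hr, le_div_iff₀ hβ]
    have : 1 * 1 ≤ T * Real.log K := mul_le_mul hT hlogK (by norm_num) (by linarith)
    nlinarith
  have hr0 : 0 < r := by linarith
  set L := Real.log r with hL
  have hL1 : 1 ≤ L := by
    rw [hL, Real.le_log_iff_exp_le hr0]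
    have := Real.exp_one_lt_d9
    linarith
  -- The exponent has room for a factor `K` besides the logarithm `L`; this factor absorbs the `7 *
  -- K` of the union bound.
  have hE : K * L ≤ p ^ 4 * N / 32 := by
    have h1 : p ^ 4 * (64 * x ^ 8 * K ^ 2 * L) / 32 ≤ p ^ 4 * N / 32 := by gcongr
    refine le_trans ?_ h1
    have h2 : p ^ 4 * (64 * x ^ 8 * K ^ 2 * L) / 32 = x ^ 4 / (2048 * K ^ 2) * L := by
      rw [hp]; field_simp; norm_num
    rw [h2]
    refine mul_le_mul_of_nonneg_right ?_ (by linarith)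
    rw [le_div_iff₀ (by positivity)]
    have hK3 : K ^ 3 ≤ K ^ 4 := pow_le_pow_right₀ (by linarith) (by norm_num)
    have hx2 : 2 ≤ x := by
      refine le_trans ?_ hx
      have := one_le_pow₀ (n := 4) (show 1 ≤ K by linarith)
      linarith
    have hx21 : 2 * x ≤ x ^ 2 := by nlinarith
    have hx4 : x ^ 2 ≤ x ^ 4 := pow_le_pow_right₀ (by linarith) (by norm_num)
    calc K * (2048 * K ^ 2) = 2 * (2 ^ 10 * K ^ 3) := by ring
      _ ≤ 2 * (2 ^ 10 * K ^ 4) := by gcongr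
      _ ≤ 2 * x := by gcongr
      _ ≤ x ^ 4 := hx21.trans hx4
  -- From `(K - 1) * (L - 1) ≥ 0` one gets `K * L ≥ L + (K - 1)`.
  have hexp : Real.exp (-(p ^ 4 * N / 32)) ≤ Real.exp (-L) * Real.exp (-(K - 1)) := by
    rw [← Real.exp_add, Real.exp_le_exp]
    nlinarith
  have hexpL : Real.exp (-L) = β / (5 * T * Real.log K) := by
    rw [Real.exp_neg, hL, Real.exp_log hr0, hr, inv_div]
  have hexpK : 7 * K * Real.exp (-(K - 1)) ≤ 5 := by
    rw [Real.exp_neg, ← div_eq_mul_inv, div_le_iff₀ (Real.exp_pos _)]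
    have := Real.quadratic_le_exp_of_nonneg (show 0 ≤ K - 1 by linarith)
    nlinarith
  have hTlog : 0 < T * Real.log K := by positivity
  calc T * (7 * K * Real.exp (-(p ^ 4 * N / 32)))
      ≤ T * (7 * K * (Real.exp (-L) * Real.exp (-(K - 1)))) := by gcongr
    _ = T * Real.exp (-L) * (7 * K * Real.exp (-(K - 1))) := by ring
    _ ≤ T * Real.exp (-L) * 5 := by gcongr
    _ = β / Real.log K := by
        rw [hexpL]
        field_simp
    _ ≤ β := div_le_self hβ.le hlogK

end Numbers

end DPSOA

theorem mainTheorem3 {X : Type*} (H : Set (X → Bool)) (d : ℕ)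
    (hd : DPSOA.littlestoneDim H = d)
    (A : DPSOA.Learner X) (hA : DPSOA.HasMistakeBound A H d)
    (T m k₁ k₂ : ℕ) (hm : k₁ = 2 ^ m)
    (pick : Fin T → DPSOA.Sample X → DPSOA.Sample X → X)
    (hpick : ∀ (t : Fin T) (S₁ S₂ : DPSOA.Sample X), A S₁ ≠ A S₂ →
      A S₁ (pick t S₁ S₂) ≠ A S₂ (pick t S₁ S₂))
    (v₀ : Fin k₂ → DPSOA.Leaf m)
    (data : Fin T → X × Bool)
    (hstar : X → Bool) (hstar_mem : hstar ∈ H)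
    (hdata : ∀ t, hstar (data t).1 = (data t).2)
    (β : ℝ) (hβ : 0 < β)
    (hk₁ : max (2 ^ (d + 1)) 20 ≤ k₁)
    (hk₂ : (2 : ℝ) ^ (8 * k₁ + 6) * (k₁ : ℝ) ^ 2 *
      Real.log (5 * (T : ℝ) * Real.log (k₁ : ℝ) / β) ≤ (k₂ : ℝ)) :
    1 - β ≤ (DPSOA.seedLaw T k₂ m).real
      {ω | ∀ t : Fin T, ∃ f : X → Bool,
        DPSOA.eta k₁ ≤ DPSOA.freq (DPSOA.outputs A pick v₀ data ω t) (some f)} := by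
  classical
  subst hm
  rcases le_or_gt 1 β with hβ1 | hβ1
  · exact le_trans (by linarith) measureReal_nonneg
  have hdm : d < m :=
    Nat.succ_le_iff.1 ((Nat.pow_le_pow_iff_right (by norm_num)).1 ((le_max_left _ _).trans hk₁))
  -- A power of two that is at least `20` is at least `32`.
  have hm5 : 5 ≤ m := by
    by_contra! hlt
    have h1 : 2 ^ m ≤ 2 ^ 4 := Nat.pow_le_pow_right (by norm_num) (by omega)
    have h2 := (le_max_right _ _).trans hk₁
    omega
  have hx : (2 : ℝ) ^ 10 * (2 ^ m) ^ 4 ≤ 2 ^ (2 ^ m) := by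
    rw [← pow_mul, ← pow_add, mul_comm m 4]
    exact pow_le_pow_right₀ (by norm_num) (DPSOA.ten_add_four_mul_le_two_pow hm5)
  have hK : (32 : ℝ) ≤ 2 ^ m := by
    calc (32 : ℝ) = 2 ^ 5 := by norm_num
      _ ≤ 2 ^ m := pow_le_pow_right₀ (by norm_num) hm5
  have hx8 : (2 : ℝ) ^ (8 * 2 ^ m + 6) = 64 * (2 ^ (2 ^ m)) ^ 8 := by
    rw [pow_add, mul_comm 8, pow_mul]; ring
  push_cast at hk₂
  rw [hx8] at hk₂
  obtain ⟨c₀⟩ : Nonempty (DPSOA.Chooser m) := ⟨fun s => ⟨s.2.choose, s.2.choose_spec⟩⟩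
  rw [DPSOA.seedLaw_real]
  rcases Nat.eq_zero_or_pos T with rfl | hT
  · have hne : Nonempty (DPSOA.Seed 0 k₂ m) :=
      ⟨⟨fun t => t.elim0, fun _ _ => false, fun _ => c₀⟩⟩
    exact DPSOA.one_sub_le_of_forall (δ := 0)
      (dR := fun _ _ => Classical.propDecidable _) (fun t => t.elim0) (by simpa using hβ.le)
  have hT1 : (1 : ℝ) ≤ T := by exact_mod_cast hT
  -- The logarithm in the lower bound for `k₂` is positive, because `T ≥ 1`, `log K ≥ 1` and `β <
  -- 1`.
  have hk : 0 < k₂ := by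
    have hlogK : 1 ≤ Real.log ((2 : ℝ) ^ m) := by
      rw [Real.le_log_iff_exp_le (by positivity)]
      have := Real.exp_one_lt_d9
      linarith
    have hr : 1 < 5 * (T : ℝ) * Real.log (2 ^ m) / β := by
      rw [lt_div_iff₀ hβ]
      nlinarith
    have hL := Real.log_pos hr
    have : (0 : ℝ) < k₂ := lt_of_lt_of_le (by positivity) hk₂
    exact_mod_cast this
  have hne : Nonempty (DPSOA.Seed T k₂ m) :=
    ⟨⟨fun _ => (⟨0, hk⟩, v₀ ⟨0, hk⟩), fun _ _ => false, fun _ => c₀⟩⟩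
  exact DPSOA.one_sub_le_of_forall (fun t => DPSOA.card_not_frequent_le (v₀ := v₀) hA hstar_mem hdm
    hpick hdata hk hx rfl t) (DPSOA.tail_bound hK hx hT1 hβ hβ1 rfl hk₂)
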